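/- All rings are associative with unit, not necessarily commutative; modules are left modules, and right modules over a ring $S$ are modules over $S^{\mathrm{op}}$. Let $R$ be a ring that is Noetherian on both sides and let $\varphi\colon R\to A$ be a ring homomorphism such that $A$ is finitely generated both as a left and as a right $R$-module. Assume: 1. $\varphi$ is a quasi-faithfully flat extension, i.e. there is an $A$-$R$-bimodule $T$ such that $T$ is finitely generated projective as a left $A$-module, $T$ is faithfully flat as a right $R$-module, and $\operatorname{Hom}_A(T,A)$ is flat as a left $R$-module (with $(rf)(t)=f(tr)$); 2. $A$ is Gorenstein projective as a left $R$-module, i.e. isomorphic to the image of a differential of an acyclic complex $\mathbf P$ of projective $R$-modules such that $\operatorname{Hom}_R(\mathbf P,Q)$ is acyclic for every projective $R$-module $Q$; 3. $\operatorname{Hom}_R(A,R)$ is projective as a left $A$-module (with $(af)(x)=f(xa)$). For $S\in\{R,A\}$ and $k>0$, a finitely generated left $S$-module $M$ is called $k$-torsionfree if $\operatorname{Ext}^i_{S^{\mathrm{op}}}(\operatorname{Tr}_S M,S)=0$ for all $1\le i\le k$, where $\operatorname{Tr}_S M$ is the cokernel of $\operatorname{Hom}_S(f,S)\colon\operatorname{Hom}_S(P_0,S)\to\operatorname{Hom}_S(P_1,S)$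 for an exact sequence $P_1\xrightarrow{f}P_0\to M\to 0$ with $P_0,P_1$ finitely generated projective (the condition does not depend on the choice of this sequence). The class of $k$-torsionfree $S$-modules is closed under extensions if for every short exact sequence $0\to X\to Y\to Z\to 0$ of finitely generated left $S$-modules with $X$ and $Z$ $k$-torsionfree, $Y$ is $k$-torsionfree. Then for each integer $k>0$, the class of $k$-torsionfree left $R$-modules is closed under extensions if and only if the class of $k$-torsionfree left $A$-modules is closed under extensions. -/

import Mathlib

open CategoryTheory MulOpposite
open scoped TensorProduct

universe u

/-! All modules are left modules; a right module over `R` is a module over `Rᵐᵒᵖ`. An `A`-`R`-bimodule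
is a type with `Module A` and `Module Rᵐᵒᵖ` structures whose actions commute. -/

noncomputable section

namespace TorsionfreeExt

/-! ### Tensor products and flatness over a noncommutative ring -/

section Tensor

variable (R : Type u) [Ring R]

/-- The subgroup of `N ⊗[ℤ] M` generated by the elements `n r ⊗ m - n ⊗ r m`. -/
def balancedRelations (N M : Type u) [AddCommGroup N] [Module Rᵐᵒᵖ N]
    [AddCommGroup M] [Module R M] : AddSubgroup (N ⊗[ℤ] M) :=
  AddSubgroup.closure
    {x | ∃ (n : N) (r : R) (m : M), x = (op r • n) ⊗ₜ[ℤ] m - n ⊗ₜ[ℤ] (r • m)}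

/-- The abelian group `N ⊗_R M` of a right `R`-module `N` and a left `R`-module `M`. -/
abbrev BalancedTensor (N M : Type u) [AddCommGroup N] [Module Rᵐᵒᵖ N]
    [AddCommGroup M] [Module R M] : Type u :=
  (N ⊗[ℤ] M) ⧸ balancedRelations R N M

variable {R}

/-- The map `f ⊗ g : N ⊗_R M → N' ⊗_R M'`. -/
def BalancedTensor.map {N N' M M' : Type u} [AddCommGroup N] [Module Rᵐᵒᵖ N]
    [AddCommGroup N'] [Module Rᵐᵒᵖ N'] [AddCommGroup M] [Module R M]
    [AddCommGroup M'] [Module R M'] (f : N →ₗ[Rᵐᵒᵖ] N') (g : M →ₗ[R] M') :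
    BalancedTensor R N M →+ BalancedTensor R N' M' :=
  QuotientAddGroup.map _ _
    (TensorProduct.map f.toAddMonoidHom.toIntLinearMap
      g.toAddMonoidHom.toIntLinearMap).toAddMonoidHom (by
      refine (AddSubgroup.closure_le _).2 ?_
      rintro _ ⟨n, r, m, rfl⟩
      refine AddSubgroup.subset_closure ⟨f n, r, g m, ?_⟩
      refine (map_sub _ _ _).trans ?_
      exact congrArg₂ (fun a b => a ⊗ₜ[ℤ] g m - f n ⊗ₜ[ℤ] b) (map_smul f (op r) n) (map_smul g r m))

variable (R)

/-- The left `R`-module `M` is flat: `- ⊗_R M` preserves injectivity. -/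
def IsFlatLeft (M : Type u) [AddCommGroup M] [Module R M] : Prop :=
  ∀ (N N' : Type u) [AddCommGroup N] [Module Rᵐᵒᵖ N] [AddCommGroup N'] [Module Rᵐᵒᵖ N']
    (f : N →ₗ[Rᵐᵒᵖ] N'), Function.Injective f →
    Function.Injective (BalancedTensor.map f (LinearMap.id : M →ₗ[R] M))

/-- The right `R`-module `N` is flat: `N ⊗_R -` preserves injectivity. -/
def IsFlatRight (N : Type u) [AddCommGroup N] [Module Rᵐᵒᵖ N] : Prop :=
  ∀ (M M' : Type u) [AddCommGroup M] [Module R M] [AddCommGroup M'] [Module R M']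
    (g : M →ₗ[R] M'), Function.Injective g →
    Function.Injective (BalancedTensor.map (LinearMap.id : N →ₗ[Rᵐᵒᵖ] N) g)

/-- The right `R`-module `N` is faithfully flat: it is flat, and `N ⊗_R M = 0` only for `M = 0`. -/
def IsFaithfullyFlatRight (N : Type u) [AddCommGroup N] [Module Rᵐᵒᵖ N] : Prop :=
  IsFlatRight R N ∧
    ∀ (M : Type u) [AddCommGroup M] [Module R M],
      Subsingleton (BalancedTensor R N M) → Subsingleton M

end Tensor

/-! ### Quasi-faithfully flat extensions -/

section QuasiFaithfullyFlat

/-- For an `A`-`R`-bimodule `T`, the group `Hom_A(T, A)` as a left `R`-module via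
`(r • f) t = f (t r)`. -/
def BimoduleDual (A R T : Type u) [Ring A] [Ring R] [AddCommGroup T] [Module A T] [Module Rᵐᵒᵖ T]
    [SMulCommClass A Rᵐᵒᵖ T] : Type u :=
  T →ₗ[A] A

instance {A R T : Type u} [Ring A] [Ring R] [AddCommGroup T] [Module A T] [Module Rᵐᵒᵖ T]
    [SMulCommClass A Rᵐᵒᵖ T] :
    AddCommGroup (BimoduleDual A R T) :=
  inferInstanceAs (AddCommGroup (T →ₗ[A] A))

instance {A R T : Type u} [Ring A] [Ring R] [AddCommGroup T] [Module A T] [Module Rᵐᵒᵖ T]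
    [SMulCommClass A Rᵐᵒᵖ T] :
    Module R (BimoduleDual A R T) where
  smul r f :=
    { toFun := fun t => (show T →ₗ[A] A from f) (op r • t)
      map_add' := fun s t => by rw [smul_add, map_add]
      map_smul' := fun a t => by rw [← smul_comm, map_smul, RingHom.id_apply] }
  one_smul f := LinearMap.ext fun t =>
    congrArg (show T →ₗ[A] A from f) (one_smul Rᵐᵒᵖ t)
  mul_smul r s f := LinearMap.ext fun t =>
    congrArg (show T →ₗ[A] A from f) (mul_smul (op s) (op r) t)
  smul_zero _ := rfl
  smul_add _ _ _ := rfl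
  add_smul r s f := LinearMap.ext fun t =>
    (congrArg (show T →ₗ[A] A from f) (add_smul (op r) (op s) t)).trans (map_add _ _ _)
  zero_smul f := LinearMap.ext fun t =>
    (congrArg (show T →ₗ[A] A from f) (zero_smul Rᵐᵒᵖ t)).trans (map_zero _)

end QuasiFaithfullyFlat

/-- `φ : R → A` is a quasi-faithfully flat extension: there is an `A`-`R`-bimodule `T`, finitely
generated projective over `A` and faithfully flat as a right `R`-module, with `Hom_A(T, A)` flat as
a left `R`-module. (The definition involves only the rings at the two ends of `φ`.) -/
def IsQuasiFaithfullyFlat {R A : Type u} [Ring R] [Ring A] (_φ : R →+* A) : Prop :=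
  ∃ (T : Type u) (_ : AddCommGroup T) (_ : Module A T) (_ : Module Rᵐᵒᵖ T)
    (_ : SMulCommClass A Rᵐᵒᵖ T),
    Module.Finite A T ∧ Module.Projective A T ∧
    IsFaithfullyFlatRight R T ∧ IsFlatLeft R (BimoduleDual A R T)

/-! ### Finite ring homomorphisms -/

/-- `A` as a left `R`-module, `r • a = φ r * a`. -/
abbrev leftModuleVia {R A : Type u} [Ring R] [Ring A] (φ : R →+* A) : ModuleCat.{u} R :=
  (ModuleCat.restrictScalars φ).obj (ModuleCat.of A A)

/-- `A` as a right `R`-module, `a r = a * φ r`. -/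
abbrev rightModuleVia {R A : Type u} [Ring R] [Ring A] (φ : R →+* A) : ModuleCat.{u} Rᵐᵒᵖ :=
  (ModuleCat.restrictScalars (RingHom.op φ)).obj (ModuleCat.of Aᵐᵒᵖ A)

/-- `φ` is finite: `A` is finitely generated as a left and as a right `R`-module. -/
def IsFiniteHom {R A : Type u} [Ring R] [Ring A] (φ : R →+* A) : Prop :=
  Module.Finite R (leftModuleVia φ) ∧ Module.Finite Rᵐᵒᵖ (rightModuleVia φ)

/-! ### Gorenstein projective modules -/

/-- A totally acyclic complex of projective `R`-modules: an acyclic complex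
`⋯ → X (i + 1) → X i → X (i - 1) → ⋯` (`d i : X (i + 1) → X i`) of projective modules that remains
acyclic after applying `Hom_R(-, Q)` for every projective module `Q`. -/
structure TotallyAcyclicComplex (R : Type u) [Ring R] where
  X : ℤ → ModuleCat.{u} R
  d : ∀ i, X (i + 1) →ₗ[R] X i
  projective : ∀ i, Module.Projective R (X i)
  exact : ∀ i, Function.Exact (d (i + 1)) (d i)
  exact_hom : ∀ (Q : Type u) [AddCommGroup Q] [Module R Q], Module.Projective R Q →
    ∀ i, Function.Exact (fun g : X i →ₗ[R] Q => g ∘ₗ d i)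
      (fun g : X (i + 1) →ₗ[R] Q => g ∘ₗ d (i + 1))

/-- `M` is Gorenstein projective: it is isomorphic to the image of a fixed differential of a totally
acyclic complex of projective modules (which one is irrelevant, by shifting the complex). -/
def IsGorensteinProjective (R : Type u) [Ring R] (M : Type u) [AddCommGroup M] [Module R M] :
    Prop :=
  ∃ P : TotallyAcyclicComplex R, Nonempty (M ≃ₗ[R] LinearMap.range (P.d 0))

/-! ### Transposes and `k`-torsionfree modules -/

/-- An exact sequence `P₁ → P₀ → M → 0` with `P₀`, `P₁` finitely generated projective. -/
structure ProjPresentation (R : Type u) [Ring R] (M : Type u) [AddCommGroup M] [Module R M] where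
  P₁ : ModuleCat.{u} R
  P₀ : ModuleCat.{u} R
  finite₁ : Module.Finite R P₁
  finite₀ : Module.Finite R P₀
  projective₁ : Module.Projective R P₁
  projective₀ : Module.Projective R P₀
  f : P₁ →ₗ[R] P₀
  π : P₀ →ₗ[R] M
  exact : Function.Exact f π
  surjective : Function.Surjective π

/-- The transpose of `M` attached to a presentation: the right `R`-module
`Coker (Hom_R(f, R) : Hom_R(P₀, R) → Hom_R(P₁, R))`. -/
abbrev ProjPresentation.transpose {R : Type u} [Ring R] {M : Type u} [AddCommGroup M] [Module R M]
    (p : ProjPresentation R M) : Type u :=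
  (p.P₁ →ₗ[R] R) ⧸ LinearMap.range (LinearMap.lcomp Rᵐᵒᵖ R p.f)

/-- The (full subcategory of) `k`-torsionfree left `R`-modules: finitely generated modules `M` with
`Ext^i(Tr M, R) = 0` over `Rᵐᵒᵖ` for `1 ≤ i ≤ k`. The transpose is unique up to projective
summands, so that the choice of the presentation does not matter. -/
def kTorsionfree (R : Type u) [Ring R] (k : ℕ) : ObjectProperty (ModuleCat.{u} R) := fun M =>
  Module.Finite R M ∧ ∃ p : ProjPresentation R M, ∀ i : ℕ, 1 ≤ i → i ≤ k →
    Subsingleton (Abelian.Ext (ModuleCat.of Rᵐᵒᵖ p.transpose) (ModuleCat.of Rᵐᵒᵖ R) i)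

end TorsionfreeExt

end

/-!
Both implications rest on a functor that takes extensions to extensions and that preserves and
reflects `k`-torsionfreeness, for every `k`. Restriction of scalars along `φ` carries closure under
extensions from `R` to `A`, and `T ⊗_R -`, for the bimodule `T` of the quasi-faithfully flat
extension, carries it from `A` to `R`.

The condition on `Ext` groups of the transpose is first made recursive. Call `g : M → P` a left
approximation when every functional on `M` extends along `g`. If `P` is finitely generated
projective and `C` is the cokernel of `g`, then `Tr C` is a syzygy of `Tr M` and `Ext¹(Tr M, S)` is
the kernel of `g`; hence `M` is `(k + 1)`-torsionfree if and only if `g` is injective and `C` is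
`k`-torsionfree (`torsionfreeModule_succ_iff`). It then suffices that both functors take
approximations to approximations, and preserve and reflect the injectivity of the maps involved.

For restriction, `Hom_R(M, R) = Hom_A(M, Hom_R(A, R))` and the projectivity of `Hom_R(A, R)` over
`A` show that an approximation `M → Aⁿ` over `A` is one over `R`. Its target is no longer
projective, but it is Gorenstein projective, hence `k`-torsionfree for all `k`
(`HasProjCoresolution.torsionfree`). Such targets are as good as projective ones, because
torsionfreeness behaves well in exact sequences with exact dual (`torsionfree_left`,
`torsionfree_right`, both by the horseshoe construction `exists_horseshoe`).

For the tensor product, `Hom_A(T ⊗_R M, A) = Hom_R(M, Hom_A(T, A))`. Since `Hom_A(T, A)` is flat,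
maps from `M` to it factor through projective modules (`IsFlatLeft.exists_factorization`), so they
extend along approximations; faithful flatness of `T` handles injectivity.
-/

noncomputable section

namespace TorsionfreeExt

section Basic

variable {S : Type u} [Ring S] {M P C : Type u} [AddCommGroup M] [Module S M]
  [AddCommGroup P] [Module S P] [AddCommGroup C] [Module S C]

/-! ### Dimension shifting for `Ext` -/

/-- In a short exact sequence `0 → K → P → N → 0` with `P` projective, `Ext¹(N, Y)` is the
cokernel of `Hom(P, Y) → Hom(K, Y)`. -/
theorem subsingleton_ext_one_iff {K N Y P : ModuleCat.{u} S}
    [Module.Projective S P] (i : K →ₗ[S] P) (q : P →ₗ[S] N) (hi : Function.Injective i)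
    (hex : Function.Exact i q) (hq : Function.Surjective q) :
    Subsingleton (Abelian.Ext N Y 1) ↔ ∀ l : K →ₗ[S] Y, ∃ m : P →ₗ[S] Y, m ∘ₗ i = l := by
  have hS : (ModuleCat.shortComplexOfCompEqZero i q hex.linearMap_comp_eq_zero).ShortExact :=
    ModuleCat.shortComplex_shortExact _ hex hi hq
  have hP : Projective P := (IsProjective.iff_projective P).1 inferInstance
  constructor
  · intro h l
    obtain ⟨x, hx⟩ := Abelian.Ext.contravariant_sequence_exact₁ hS Y
      (Abelian.Ext.mk₀ (ModuleCat.ofHom l)) (add_zero 1) (Subsingleton.elim _ _)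
    obtain ⟨m, rfl⟩ := Abelian.Ext.addEquiv₀.symm.surjective x
    refine ⟨m.hom, ?_⟩
    have hx' : Abelian.Ext.mk₀ (ModuleCat.ofHom i ≫ m) = Abelian.Ext.mk₀ (ModuleCat.ofHom l) := by
      rw [← hx, ← Abelian.Ext.mk₀_comp_mk₀]
      rfl
    have := congrArg ModuleCat.Hom.hom (Abelian.Ext.addEquiv₀.symm.injective hx')
    exact this
  · intro h
    refine subsingleton_of_forall_eq 0 fun x => ?_
    obtain ⟨y, rfl⟩ := Abelian.Ext.contravariant_sequence_exact₃ hS Y x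
      (Abelian.Ext.eq_zero_of_projective (P := P) _) (add_zero 1)
    obtain ⟨l, rfl⟩ := Abelian.Ext.addEquiv₀.symm.surjective y
    obtain ⟨m, hm⟩ := h l.hom
    have hy : Abelian.Ext.addEquiv₀.symm l =
        (Abelian.Ext.mk₀ (ModuleCat.ofHom i)).comp (Abelian.Ext.mk₀ (ModuleCat.ofHom m))
          (add_zero 0) := by
      rw [Abelian.Ext.mk₀_comp_mk₀, ← ModuleCat.ofHom_comp, hm]
      rfl
    rw [hy]
    exact hS.extClass_comp_assoc _

/-- In a short exact sequence `0 → K → P → N → 0` with `P` projective, `Extⁿ⁺²(N, Y)` and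
`Extⁿ⁺¹(K, Y)` are isomorphic. -/
theorem subsingleton_ext_succ_iff {K N Y P : ModuleCat.{u} S}
    [Module.Projective S P] (i : K →ₗ[S] P) (q : P →ₗ[S] N) (hi : Function.Injective i)
    (hex : Function.Exact i q) (hq : Function.Surjective q) (n : ℕ) :
    Subsingleton (Abelian.Ext N Y (n + 2)) ↔ Subsingleton (Abelian.Ext K Y (n + 1)) := by
  have hS : (ModuleCat.shortComplexOfCompEqZero i q hex.linearMap_comp_eq_zero).ShortExact :=
    ModuleCat.shortComplex_shortExact _ hex hi hq
  have hP : Projective P := (IsProjective.iff_projective P).1 inferInstance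
  have hn : 1 + (n + 1) = n + 2 := by omega
  constructor
  · intro h
    refine subsingleton_of_forall_eq 0 fun x => ?_
    obtain ⟨y, rfl⟩ := Abelian.Ext.contravariant_sequence_exact₁ hS Y x hn (Subsingleton.elim _ _)
    have hy : y = 0 := Abelian.Ext.eq_zero_of_projective (P := P) y
    rw [hy, Abelian.Ext.comp_zero]
  · intro h
    refine subsingleton_of_forall_eq 0 fun x => ?_
    obtain ⟨y, rfl⟩ := Abelian.Ext.contravariant_sequence_exact₃ hS Y x
      (Abelian.Ext.eq_zero_of_projective (P := P) _) hn
    rw [Subsingleton.elim y 0, Abelian.Ext.comp_zero]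

/-! ### Duals of finitely generated projective modules -/

/-- The dual basis formula: for `s ∘ i = id` with `s : Sⁿ → P`, the coordinates of `i` generate
`Hom_S(P, S)` as a right module. -/
theorem eq_sum_smul_coord {n : ℕ} {s : (Fin n → S) →ₗ[S] P} {i : P →ₗ[S] Fin n → S}
    (hsi : s ∘ₗ i = LinearMap.id) (α : P →ₗ[S] S) :
    α = ∑ j, op (α (s (Pi.single j 1))) • (LinearMap.proj j ∘ₗ i) := by
  ext x
  have hx : s (i x) = x := LinearMap.congr_fun hsi x
  conv_lhs => rw [← hx, pi_eq_sum_univ' (i x)]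
  simp [LinearMap.sum_apply, map_sum]

/-- The right `S`-module `Hom_S(P, S)` is a retract of `S ^ n` whenever `P` is. -/
theorem projective_dual [Module.Finite S P] [Module.Projective S P] :
    Module.Projective Sᵐᵒᵖ (P →ₗ[S] S) := by
  obtain ⟨n, s, i, -, -, hsi⟩ := Module.Finite.exists_comp_eq_id_of_projective S P
  have : Module.Free Sᵐᵒᵖ S := Module.Free.of_equiv (opLinearEquiv Sᵐᵒᵖ (M := S)).symm
  let toPi : (P →ₗ[S] S) →ₗ[Sᵐᵒᵖ] (Fin n → S) :=
    LinearMap.pi fun j => LinearMap.applyₗ' Sᵐᵒᵖ (s (Pi.single j 1))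
  let ofPi : (Fin n → S) →ₗ[Sᵐᵒᵖ] (P →ₗ[S] S) :=
    { toFun := fun a => ∑ j, op (a j) • (LinearMap.proj j ∘ₗ i)
      map_add' := fun a b => by simp [add_smul, Finset.sum_add_distrib]
      map_smul' := fun c a => by
        simp only [Finset.smul_sum, smul_smul, RingHom.id_apply]
        rfl }
  exact Module.Projective.of_split toPi ofPi
    (LinearMap.ext fun α => (eq_sum_smul_coord hsi α).symm)

/-- A finitely generated projective module is reflexive: every functional on its dual is the
evaluation at an element. -/
theorem exists_eval_eq [Module.Finite S P] [Module.Projective S P]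
    (l : (P →ₗ[S] S) →ₗ[Sᵐᵒᵖ] S) : ∃ x : P, ∀ α, l α = α x := by
  obtain ⟨n, s, i, -, -, hsi⟩ := Module.Finite.exists_comp_eq_id_of_projective S P
  refine ⟨∑ j, l (LinearMap.proj j ∘ₗ i) • s (Pi.single j 1), fun α => ?_⟩
  conv_lhs => rw [eq_sum_smul_coord hsi α]
  simp only [map_sum, map_smul, smul_eq_mul]
  rfl

/-- A projective module is torsionless: its functionals separate elements. -/
theorem eq_zero_of_forall_dual [Module.Projective S P] {x : P}
    (hx : ∀ α : P →ₗ[S] S, α x = 0) : x = 0 := by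
  obtain ⟨s, hs⟩ := Module.projective_def'.1 ‹Module.Projective S P›
  have h0 : s x = 0 := Finsupp.ext fun j => hx (Finsupp.lapply j ∘ₗ s)
  have := LinearMap.congr_fun hs x
  rw [LinearMap.comp_apply, h0, map_zero] at this
  exact this.symm

/-- A map vanishing on the image of `f` descends to the cokernel of `f`. -/
theorem exists_comp_eq_of_exact {N Q : Type*} [AddCommGroup N] [Module S N] [AddCommGroup Q]
    [Module S Q] {f : N →ₗ[S] P} {q : P →ₗ[S] C} (hex : Function.Exact f q)
    (hq : Function.Surjective q) (α : P →ₗ[S] Q) (hα : α ∘ₗ f = 0) :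
    ∃ γ : C →ₗ[S] Q, γ ∘ₗ q = α := by
  have hker : LinearMap.ker q ≤ LinearMap.ker α := by
    rw [LinearMap.exact_iff.1 hex]
    exact LinearMap.range_le_ker_iff.2 hα
  refine ⟨(LinearMap.ker q).liftQ α hker ∘ₗ (q.quotKerEquivOfSurjective hq).symm, ?_⟩
  ext x
  have : (q.quotKerEquivOfSurjective hq).symm (q x) = (LinearMap.ker q).mkQ x := by
    rw [LinearEquiv.symm_apply_eq]
    rfl
  simp [this]

/-! ### Maps whose dual is surjective -/

/-- Every functional on `M` extends along `g`, i.e. `Hom_S(g, S)` is surjective. For `P` finitely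
generated projective this says that `g` is a left `add S`-approximation of `M`. -/
def DualSurjective (g : M →ₗ[S] P) : Prop :=
  ∀ α : M →ₗ[S] S, ∃ β : P →ₗ[S] S, β ∘ₗ g = α

/-- Over a right noetherian ring a finitely generated module has a left approximation by a free
module: its coordinates are generators of `Hom_S(M, S)`. -/
theorem exists_dualSurjective [IsNoetherianRing Sᵐᵒᵖ] (M : Type u) [AddCommGroup M] [Module S M]
    [Module.Finite S M] : ∃ (n : ℕ) (g : M →ₗ[S] Fin n → S), DualSurjective g := by
  obtain ⟨m, s, hs⟩ := Module.Finite.exists_fin' S M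
  have : IsNoetherian Sᵐᵒᵖ S := isNoetherian_of_linearEquiv (opLinearEquiv Sᵐᵒᵖ (M := S)).symm
  have : IsNoetherian Sᵐᵒᵖ (M →ₗ[S] S) :=
    isNoetherian_of_injective
      (LinearMap.pi fun j => LinearMap.applyₗ' Sᵐᵒᵖ (s (Pi.single j 1)) :
        (M →ₗ[S] S) →ₗ[Sᵐᵒᵖ] (Fin m → S)) (by
      intro α β h
      have h1 : α ∘ₗ s = β ∘ₗ s := by
        refine LinearMap.pi_ext' fun j => LinearMap.ext_ring ?_
        exact congrFun h j
      exact LinearMap.ext fun x => by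
        obtain ⟨y, rfl⟩ := hs x
        exact LinearMap.congr_fun h1 y)
  obtain ⟨n, t, ht⟩ := Module.Finite.exists_fin' Sᵐᵒᵖ (M →ₗ[S] S)
  refine ⟨n, LinearMap.pi fun j => t (Pi.single j 1), fun α => ?_⟩
  obtain ⟨c, rfl⟩ := ht α
  refine ⟨∑ j, c j • LinearMap.proj j, ?_⟩
  conv_rhs => rw [pi_eq_sum_univ' c]
  ext x
  simp [LinearMap.sum_apply, map_sum]

/-- If functionals on a finitely generated module `M` extend along `g`, then so do maps from `M` to
any projective module, finitely generated or not. -/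
theorem DualSurjective.exists_extend {g : M →ₗ[S] P} (hg : DualSurjective g) [Module.Finite S M]
    {Q : Type*} [AddCommGroup Q] [Module S Q] [Module.Projective S Q] (u : M →ₗ[S] Q) :
    ∃ v : P →ₗ[S] Q, v ∘ₗ g = u := by
  classical
  obtain ⟨s, hs⟩ := Module.projective_def'.1 ‹Module.Projective S Q›
  obtain ⟨m, t, ht⟩ := Module.Finite.exists_fin' S M
  -- The image of `M` involves only the finitely many coordinates in `F`.
  let F : Finset Q := Finset.univ.biUnion fun j => (s (u (t (Pi.single j 1)))).support
  have hF : ∀ x, s (u x) ∈ Finsupp.supported S S (F : Set Q) := by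
    intro x
    obtain ⟨y, rfl⟩ := ht x
    rw [pi_eq_sum_univ' y]
    simp only [map_sum, map_smul]
    refine Submodule.sum_mem _ fun j _ => Submodule.smul_mem _ _ ?_
    rw [Finsupp.mem_supported]
    intro q hq
    exact Finset.mem_coe.2 (Finset.mem_biUnion.2 ⟨j, Finset.mem_univ _, hq⟩)
  choose β hβ using fun q : Q => hg (Finsupp.lapply q ∘ₗ s ∘ₗ u)
  refine ⟨Finsupp.linearCombination S id ∘ₗ ∑ q ∈ F, Finsupp.lsingle q ∘ₗ β q, ?_⟩
  ext x
  have h1 : ∀ q, β q (g x) = s (u x) q := fun q => LinearMap.congr_fun (hβ q) x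
  have h2 : ∑ q ∈ F, Finsupp.single q (s (u x) q) = s (u x) := by
    conv_rhs => rw [← Finsupp.sum_single (s (u x))]
    exact (Finsupp.sum_of_support_subset _
      (Finset.coe_subset.1 ((Finsupp.mem_supported _ _).1 (hF x))) _ (by simp)).symm
  have h3 : (∑ q ∈ F, Finsupp.lsingle q ∘ₗ β q) (g x) = s (u x) := by
    rw [← h2, LinearMap.sum_apply]
    exact Finset.sum_congr rfl fun q _ => by simp [h1]
  rw [LinearMap.comp_apply, LinearMap.comp_apply, h3]
  exact LinearMap.congr_fun hs (u x)

/-! ### The transpose of a cokernel of an approximation -/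

/-- The presentation `P₀ → P → C → 0` of the cokernel of `g : M → P` attached to a presentation
`P₁ → P₀ → M → 0`. -/
def ProjPresentation.shift [Module.Finite S P] [Module.Projective S P] (p : ProjPresentation S M)
    {g : M →ₗ[S] P} {h : P →ₗ[S] C} (hex : Function.Exact g h) (hh : Function.Surjective h) :
    ProjPresentation S C where
  P₁ := p.P₀
  P₀ := ModuleCat.of S P
  finite₁ := p.finite₀
  finite₀ := inferInstanceAs (Module.Finite S P)
  projective₁ := p.projective₀
  projective₀ := inferInstanceAs (Module.Projective S P)
  f := g ∘ₗ p.π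
  π := h
  exact := p.surjective.comp_exact_iff_exact.2 hex
  surjective := hh

/-- `Ext^i(Tr M, S) = 0` for `1 ≤ i ≤ k`, where `Tr M` is computed by the presentation `p`. -/
def ProjPresentation.ExtVanishing (p : ProjPresentation S M) (k : ℕ) : Prop :=
  ∀ i : ℕ, 1 ≤ i → i ≤ k →
    Subsingleton (Abelian.Ext (ModuleCat.of Sᵐᵒᵖ p.transpose) (ModuleCat.of Sᵐᵒᵖ S) i)

/-- If `g : M → P` is a left approximation with cokernel `C`, then `Tr C` is a syzygy of `Tr M`,
and `Ext¹(Tr M, S)` is the kernel of `g`. -/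
theorem ProjPresentation.extVanishing_succ_iff [Module.Finite S P] [Module.Projective S P]
    (p : ProjPresentation S M) {g : M →ₗ[S] P} {h : P →ₗ[S] C} (hg : DualSurjective g)
    (hex : Function.Exact g h) (hh : Function.Surjective h) (k : ℕ) :
    p.ExtVanishing (k + 1) ↔ Function.Injective g ∧ (p.shift hex hh).ExtVanishing k := by
  have := p.finite₁; have := p.finite₀; have := p.projective₁; have := p.projective₀
  have : Module.Projective Sᵐᵒᵖ (p.P₁ →ₗ[S] S) := projective_dual
  let q := p.shift hex hh
  have hfπ : (LinearMap.lcomp Sᵐᵒᵖ S p.f) ∘ₗ (LinearMap.lcomp Sᵐᵒᵖ S q.f) = 0 := by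
    ext α x
    have : p.π (p.f x) = 0 := p.exact.apply_apply_eq_zero x
    change α (g (p.π (p.f x))) = 0
    rw [this, map_zero]
    exact map_zero α
  let i : q.transpose →ₗ[Sᵐᵒᵖ] (p.P₁ →ₗ[S] S) :=
    (LinearMap.range (LinearMap.lcomp Sᵐᵒᵖ S q.f)).liftQ (LinearMap.lcomp Sᵐᵒᵖ S p.f)
      (LinearMap.range_le_ker_iff.2 hfπ)
  have hi : Function.Injective i := by
    rw [← LinearMap.ker_eq_bot, LinearMap.ker_eq_bot']
    intro a ha
    obtain ⟨α, rfl⟩ := Submodule.mkQ_surjective _ a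
    have hα : α ∘ₗ p.f = 0 := ha
    -- `α` vanishes on the image of `P₁`, so it comes from a functional on `M`.
    obtain ⟨γ, hγ⟩ := exists_comp_eq_of_exact p.exact p.surjective α hα
    obtain ⟨β, rfl⟩ := hg γ
    exact (Submodule.Quotient.mk_eq_zero _).2 ⟨β, hγ⟩
  have hiq : Function.Exact i (LinearMap.range (LinearMap.lcomp Sᵐᵒᵖ S p.f)).mkQ := by
    intro a
    refine (Submodule.Quotient.mk_eq_zero _).trans ⟨?_, ?_⟩
    · rintro ⟨α, rfl⟩
      exact ⟨Submodule.Quotient.mk α, rfl⟩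
    · rintro ⟨b, rfl⟩
      obtain ⟨α, rfl⟩ := Submodule.mkQ_surjective _ b
      exact ⟨α, rfl⟩
  have hq := Submodule.mkQ_surjective (LinearMap.range (LinearMap.lcomp Sᵐᵒᵖ S p.f))
  have h1 := subsingleton_ext_one_iff (K := ModuleCat.of _ _) (N := ModuleCat.of _ _)
    (Y := ModuleCat.of _ S) (P := ModuleCat.of _ _) i _ hi hiq hq
  have hs := subsingleton_ext_succ_iff (K := ModuleCat.of _ _) (N := ModuleCat.of _ _)
    (Y := ModuleCat.of _ S) (P := ModuleCat.of _ _) i _ hi hiq hq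
  have h1' : (∀ l : q.transpose →ₗ[Sᵐᵒᵖ] S, ∃ m : (p.P₁ →ₗ[S] S) →ₗ[Sᵐᵒᵖ] S, m ∘ₗ i = l) ↔
      Function.Injective g := by
    constructor
    · intro H
      rw [injective_iff_map_eq_zero]
      intro m hm
      obtain ⟨x, rfl⟩ := p.surjective m
      -- Evaluation at `x` is a functional on the transpose of `C`.
      obtain ⟨μ, hμ⟩ := H ((LinearMap.range (LinearMap.lcomp Sᵐᵒᵖ S q.f)).liftQ
        (LinearMap.applyₗ' Sᵐᵒᵖ x) (by
          rintro _ ⟨β, rfl⟩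
          change β (g (p.π x)) = 0
          rw [hm]
          exact map_zero β))
      obtain ⟨y, hy⟩ := exists_eval_eq μ
      have hxy : p.f y - x = 0 := eq_zero_of_forall_dual (S := S) fun α => by
        have h1 : μ (α ∘ₗ p.f) = α x :=
          LinearMap.congr_fun hμ ((LinearMap.range (LinearMap.lcomp Sᵐᵒᵖ S q.f)).mkQ α)
        rw [map_sub, ← h1, hy, LinearMap.comp_apply, sub_self]
      rw [← sub_eq_zero.1 hxy]
      exact p.exact.apply_apply_eq_zero y
    · intro H l
      obtain ⟨x, hx⟩ := exists_eval_eq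
        (l ∘ₗ (LinearMap.range (LinearMap.lcomp Sᵐᵒᵖ S q.f)).mkQ : (p.P₀ →ₗ[S] S) →ₗ[Sᵐᵒᵖ] S)
      have hgx : g (p.π x) = 0 := eq_zero_of_forall_dual (S := S) fun β => by
        have h1 := hx (β ∘ₗ q.f)
        have h2 : (LinearMap.range (LinearMap.lcomp Sᵐᵒᵖ S q.f)).mkQ (β ∘ₗ q.f) = 0 :=
          (Submodule.Quotient.mk_eq_zero _).2 ⟨β, rfl⟩
        have h3 : l ((LinearMap.range (LinearMap.lcomp Sᵐᵒᵖ S q.f)).mkQ (β ∘ₗ q.f)) =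
            β (g (p.π x)) := h1
        rw [← h3, h2, map_zero]
      obtain ⟨y, rfl⟩ := (p.exact x).1 (H (hgx.trans (map_zero g).symm))
      refine ⟨LinearMap.applyₗ' Sᵐᵒᵖ y, LinearMap.ext fun a => ?_⟩
      obtain ⟨α, rfl⟩ := Submodule.mkQ_surjective _ a
      exact (hx α).symm
  rw [← h1']
  constructor
  · intro H
    refine ⟨h1.1 (H 1 le_rfl (by omega)), fun j hj hjk => ?_⟩
    obtain ⟨j, rfl⟩ := Nat.exists_eq_add_of_le' hj
    exact (hs j).1 (H (j + 2) (by omega) (by omega))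
  · rintro ⟨H1, H2⟩ j hj hjk
    obtain ⟨j, rfl⟩ := Nat.exists_eq_add_of_le' hj
    obtain _ | j := j
    · exact h1.2 H1
    · exact (hs j).2 (H2 (j + 1) (by omega) (by omega))

/-! ### Recursive description of `k`-torsionfree modules -/

theorem exists_projPresentation [IsNoetherianRing S] (M : Type u) [AddCommGroup M] [Module S M]
    [Module.Finite S M] : Nonempty (ProjPresentation S M) := by
  obtain ⟨n, π, hπ⟩ := Module.Finite.exists_fin' S M
  obtain ⟨m, f, hf⟩ := Module.Finite.exists_fin' S (LinearMap.ker π)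
  exact ⟨{
    P₁ := ModuleCat.of S (Fin m → S)
    P₀ := ModuleCat.of S (Fin n → S)
    finite₁ := inferInstanceAs (Module.Finite S (Fin m → S))
    finite₀ := inferInstanceAs (Module.Finite S (Fin n → S))
    projective₁ := inferInstanceAs (Module.Projective S (Fin m → S))
    projective₀ := inferInstanceAs (Module.Projective S (Fin n → S))
    f := (LinearMap.ker π).subtype ∘ₗ f
    π := π
    exact := hf.comp_exact_iff_exact.2 (LinearMap.exact_subtype_ker_map π)
    surjective := hπ }⟩

variable (S) in
/-- `k`-torsionfreeness of an unbundled module. -/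
abbrev TorsionfreeModule (k : ℕ) (M : Type u) [AddCommGroup M] [Module S M] : Prop :=
  kTorsionfree S k (ModuleCat.of S M)

theorem TorsionfreeModule.finite {k : ℕ} (h : TorsionfreeModule S k M) : Module.Finite S M := h.1

theorem torsionfreeModule_zero_iff [IsNoetherianRing S] :
    TorsionfreeModule S 0 M ↔ Module.Finite S M :=
  ⟨fun h => h.1, fun h => ⟨h, (exists_projPresentation M).some, fun i h1 h2 => by omega⟩⟩

/-- `k`-torsionfreeness can be tested on any presentation. -/
theorem TorsionfreeModule.extVanishing [IsNoetherianRing Sᵐᵒᵖ] {k : ℕ}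
    (h : TorsionfreeModule S k M) (p : ProjPresentation S M) : p.ExtVanishing k := by
  induction k generalizing M with
  | zero => exact fun i h1 h2 => by omega
  | succ k ih =>
    obtain ⟨hM, q, hq⟩ := h
    have : Module.Finite S M := hM
    obtain ⟨n, g, hg⟩ := exists_dualSurjective (S := S) M
    have hex := LinearMap.exact_map_mkQ_range g
    have hh := Submodule.mkQ_surjective (LinearMap.range g)
    obtain ⟨hi, hv⟩ := (q.extVanishing_succ_iff hg hex hh k).1 hq
    exact (p.extVanishing_succ_iff hg hex hh k).2 ⟨hi, ih ⟨inferInstance, _, hv⟩ _⟩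

/-- If `g : M → P` is a left approximation of `M` by a finitely generated projective module, then
`M` is `(k + 1)`-torsionfree if and only if `g` is injective with `k`-torsionfree cokernel. -/
theorem torsionfreeModule_succ_iff [IsNoetherianRing S] [IsNoetherianRing Sᵐᵒᵖ]
    [Module.Finite S M] [Module.Finite S P] [Module.Projective S P] {g : M →ₗ[S] P}
    {h : P →ₗ[S] C} (hg : DualSurjective g) (hex : Function.Exact g h)
    (hh : Function.Surjective h) (k : ℕ) :
    TorsionfreeModule S (k + 1) M ↔ Function.Injective g ∧ TorsionfreeModule S k C := by
  constructor
  · rintro ⟨-, p, hp⟩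
    obtain ⟨hi, hv⟩ := (p.extVanishing_succ_iff hg hex hh k).1 hp
    exact ⟨hi, Module.Finite.of_surjective h hh, _, hv⟩
  · rintro ⟨hi, hC⟩
    obtain ⟨p⟩ := exists_projPresentation (S := S) M
    exact ⟨‹_›, p, (p.extVanishing_succ_iff hg hex hh k).2 ⟨hi, hC.extVanishing _⟩⟩

end Basic

section DualExact

variable {S : Type u} [Ring S]

/-! ### Torsionfree modules in dual-exact sequences -/

/-- A dual-exact sequence: an exact sequence `X → Y → Z → 0` such that
`Hom_S(Y, S) → Hom_S(X, S)` is surjective. -/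
structure DualExact {X Y Z : Type u} [AddCommGroup X] [Module S X] [AddCommGroup Y] [Module S Y]
    [AddCommGroup Z] [Module S Z] (i : X →ₗ[S] Y) (q : Y →ₗ[S] Z) : Prop where
  exact : Function.Exact i q
  surjective : Function.Surjective q
  dualSurjective : DualSurjective i

/-- The functionals on a `1`-torsionfree module separate its elements. -/
theorem TorsionfreeModule.eq_zero_of_forall_dual [IsNoetherianRing S] [IsNoetherianRing Sᵐᵒᵖ]
    {k : ℕ} {X : Type u} [AddCommGroup X] [Module S X] (hX : TorsionfreeModule S (k + 1) X)
    {x : X} (hx : ∀ α : X →ₗ[S] S, α x = 0) : x = 0 := by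
  have := hX.finite
  obtain ⟨n, g, hg⟩ := exists_dualSurjective (S := S) X
  have hi := ((torsionfreeModule_succ_iff hg (LinearMap.exact_map_mkQ_range g)
    (Submodule.mkQ_surjective _) k).1 hX).1
  exact hi ((funext fun j => hx (LinearMap.proj j ∘ₗ g)).trans (map_zero g).symm)

theorem DualSurjective.injective [IsNoetherianRing S] [IsNoetherianRing Sᵐᵒᵖ]
    {k : ℕ} {X Y : Type u} [AddCommGroup X] [Module S X] [AddCommGroup Y] [Module S Y]
    {i : X →ₗ[S] Y} (hi : DualSurjective i) (hX : TorsionfreeModule S (k + 1) X) :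
    Function.Injective i := by
  rw [injective_iff_map_eq_zero]
  intro x hx
  refine hX.eq_zero_of_forall_dual fun α => ?_
  obtain ⟨β, rfl⟩ := hi α
  rw [LinearMap.comp_apply, hx, map_zero]

/-- The horseshoe construction for a dual-exact sequence `X → Y → Z → 0`: approximations
`gX : X → P` and `gZ : Z → Q` combine to an approximation `gY : Y → P × Q`, and the sequence of
cokernels is again dual-exact. -/
theorem exists_horseshoe {X Y Z P Q : Type u} [AddCommGroup X] [Module S X] [AddCommGroup Y]
    [Module S Y] [AddCommGroup Z] [Module S Z] [AddCommGroup P] [Module S P] [AddCommGroup Q]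
    [Module S Q] [Module.Projective S P] [Module.Finite S X]
    {i : X →ₗ[S] Y} {q : Y →ₗ[S] Z} (h : DualExact i q)
    {gX : X →ₗ[S] P} {gZ : Z →ₗ[S] Q} (hgX : DualSurjective gX) (hgZ : DualSurjective gZ) :
    ∃ (gY : Y →ₗ[S] P × Q) (hX : LinearMap.range gX ≤ (LinearMap.range gY).comap (.inl S P Q))
      (hY : LinearMap.range gY ≤ (LinearMap.range gZ).comap (.snd S P Q)),
      DualSurjective gY ∧ (∀ x, gY (i x) = (gX x, 0)) ∧ (∀ y, (gY y).2 = gZ (q y)) ∧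
      DualExact (Submodule.mapQ _ _ _ hX) (Submodule.mapQ _ _ _ hY) := by
  -- The extension of `gX` over `Y` exists because the dual of `i` is surjective.
  obtain ⟨e, he⟩ := h.dualSurjective.exists_extend gX
  have he' : ∀ x, e (i x) = gX x := LinearMap.congr_fun he
  have hqi : ∀ x, q (i x) = 0 := h.exact.apply_apply_eq_zero
  have hi : ∀ x, (e.prod (gZ ∘ₗ q)) (i x) = (gX x, 0) := fun x => by simp [he', hqi]
  -- A functional on `Y` vanishing on `X` extends along `gZ`.
  have key : ∀ α : Y →ₗ[S] S, α ∘ₗ i = 0 → ∃ δ : Q →ₗ[S] S, δ ∘ₗ gZ ∘ₗ q = α := by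
    intro α hα
    obtain ⟨γ, rfl⟩ := exists_comp_eq_of_exact h.exact h.surjective α hα
    obtain ⟨δ, rfl⟩ := hgZ γ
    exact ⟨δ, rfl⟩
  refine ⟨e.prod (gZ ∘ₗ q), ?_, ?_, ?_, hi, fun y => rfl, ⟨?_, ?_, ?_⟩⟩
  · rintro _ ⟨x, rfl⟩
    exact ⟨i x, hi x⟩
  · rintro _ ⟨y, rfl⟩
    exact ⟨q y, rfl⟩
  · intro α
    obtain ⟨β, hβ⟩ := hgX (α ∘ₗ i)
    obtain ⟨δ, hδ⟩ := key (α - β ∘ₗ e) (by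
      rw [LinearMap.sub_comp, ← hβ, LinearMap.comp_assoc, he, sub_self])
    refine ⟨β ∘ₗ .fst S P Q + δ ∘ₗ .snd S P Q, ?_⟩
    ext y
    have h1 := LinearMap.congr_fun hδ y
    simp only [LinearMap.comp_apply, LinearMap.sub_apply] at h1
    simp [h1]
  · intro c
    obtain ⟨⟨p, r⟩, rfl⟩ := Submodule.mkQ_surjective _ c
    constructor
    · intro hc
      obtain ⟨z, hz⟩ := (Submodule.Quotient.mk_eq_zero _).1 hc
      obtain ⟨y, rfl⟩ := h.surjective z
      refine ⟨Submodule.Quotient.mk (p - e y), (Submodule.Quotient.eq _).2 ⟨-y, ?_⟩⟩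
      ext
      · simp
      · simpa using hz
    · rintro ⟨b, hb⟩
      obtain ⟨p', rfl⟩ := Submodule.mkQ_surjective _ b
      rw [← hb]
      exact (Submodule.Quotient.mk_eq_zero _).2 ⟨0, map_zero gZ⟩
  · intro c
    obtain ⟨r, rfl⟩ := Submodule.mkQ_surjective _ c
    exact ⟨Submodule.Quotient.mk (0, r), rfl⟩
  · intro α
    have hα : ∀ x, α (Submodule.Quotient.mk (gX x)) = 0 := fun x => by
      have h0 : (Submodule.Quotient.mk (gX x) : P ⧸ LinearMap.range gX) = 0 :=
        (Submodule.Quotient.mk_eq_zero _).2 ⟨x, rfl⟩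
      rw [h0, map_zero]
    obtain ⟨δ, hδ⟩ := key (α ∘ₗ (LinearMap.range gX).mkQ ∘ₗ e) (by
      ext x
      simp [he', hα])
    refine ⟨(LinearMap.range (e.prod (gZ ∘ₗ q))).liftQ
      (α ∘ₗ (LinearMap.range gX).mkQ ∘ₗ .fst S P Q - δ ∘ₗ .snd S P Q) ?_, ?_⟩
    · rintro _ ⟨y, rfl⟩
      have h1 := LinearMap.congr_fun hδ y
      simp only [LinearMap.comp_apply] at h1
      simp [h1]
    · ext p
      simp

/-- In terms of the long exact `Ext` sequence of `0 → Tr Z → Tr Y → Tr X → 0`, this is the exactness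
at `Ext(Tr X, S)`. The proof passes to cokernels of approximations, which lowers both indices. -/
theorem torsionfree_left [IsNoetherianRing S] [IsNoetherianRing Sᵐᵒᵖ] (k : ℕ)
    {X Y Z : Type u} [AddCommGroup X] [Module S X] [AddCommGroup Y]
    [Module S Y] [AddCommGroup Z] [Module S Z] [Module.Finite S X]
    {i : X →ₗ[S] Y} {q : Y →ₗ[S] Z} (h : DualExact i q) (hi : Function.Injective i)
    (hY : TorsionfreeModule S (k + 1) Y) (hZ : TorsionfreeModule S k Z) :
    TorsionfreeModule S (k + 1) X := by
  induction k generalizing X Y Z with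
  | zero =>
    have := hY.finite
    obtain ⟨m, gX, hgX⟩ := exists_dualSurjective (S := S) X
    refine (torsionfreeModule_succ_iff hgX (LinearMap.exact_map_mkQ_range gX)
      (Submodule.mkQ_surjective _) _).2 ⟨?_, torsionfreeModule_zero_iff.2 inferInstance⟩
    rw [injective_iff_map_eq_zero]
    refine fun x hx => hi (Eq.trans (hY.eq_zero_of_forall_dual fun α => ?_) (map_zero i).symm)
    obtain ⟨β, hβ⟩ := hgX (α ∘ₗ i)
    have h1 := LinearMap.congr_fun hβ x
    rw [LinearMap.comp_apply, hx, map_zero] at h1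
    exact h1.symm
  | succ k ih =>
    have := hY.finite; have := hZ.finite
    obtain ⟨m, gX, hgX⟩ := exists_dualSurjective (S := S) X
    obtain ⟨n, gZ, hgZ⟩ := exists_dualSurjective (S := S) Z
    obtain ⟨gY, hX', hY', hgY, hi1, hq1, hC⟩ := exists_horseshoe h hgX hgZ
    obtain ⟨hYi, hCY⟩ := (torsionfreeModule_succ_iff hgY (LinearMap.exact_map_mkQ_range gY)
      (Submodule.mkQ_surjective _) _).1 hY
    obtain ⟨hZi, hCZ⟩ := (torsionfreeModule_succ_iff hgZ (LinearMap.exact_map_mkQ_range gZ)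
      (Submodule.mkQ_surjective _) _).1 hZ
    have hXi : Function.Injective gX := fun x x' hxx => hi (hYi (by rw [hi1, hi1, hxx]))
    have hCi : Function.Injective (Submodule.mapQ _ _ _ hX') := by
      rw [injective_iff_map_eq_zero]
      intro c hc
      obtain ⟨p, rfl⟩ := Submodule.mkQ_surjective _ c
      obtain ⟨y, hy⟩ := (Submodule.Quotient.mk_eq_zero _).1 hc
      have hqy : q y = 0 := hZi (by rw [← hq1, hy, map_zero]; rfl)
      obtain ⟨x, rfl⟩ := (h.exact y).1 hqy
      refine (Submodule.Quotient.mk_eq_zero _).2 ⟨x, ?_⟩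
      rw [hi1] at hy
      exact congrArg Prod.fst hy
    exact (torsionfreeModule_succ_iff hgX (LinearMap.exact_map_mkQ_range gX)
      (Submodule.mkQ_surjective _) _).2 ⟨hXi, ih hC hCi hCY hCZ⟩

/-- The companion of `torsionfree_left`, corresponding to the exactness at `Ext(Tr Z, S)`. The map
`i` is not assumed injective, as this follows from `hX`. -/
theorem torsionfree_right [IsNoetherianRing S] [IsNoetherianRing Sᵐᵒᵖ] (k : ℕ)
    {X Y Z : Type u} [AddCommGroup X] [Module S X] [AddCommGroup Y]
    [Module S Y] [AddCommGroup Z] [Module S Z]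
    {i : X →ₗ[S] Y} {q : Y →ₗ[S] Z} (h : DualExact i q)
    (hX : TorsionfreeModule S (k + 1) X) (hY : TorsionfreeModule S k Y) :
    TorsionfreeModule S k Z := by
  have := hX.finite; have := hY.finite
  have : Module.Finite S Z := Module.Finite.of_surjective q h.surjective
  induction k generalizing X Y Z with
  | zero => exact torsionfreeModule_zero_iff.2 inferInstance
  | succ k ih =>
    obtain ⟨m, gX, hgX⟩ := exists_dualSurjective (S := S) X
    obtain ⟨n, gZ, hgZ⟩ := exists_dualSurjective (S := S) Z
    obtain ⟨gY, hX', hY', hgY, hi1, hq1, hC⟩ := exists_horseshoe h hgX hgZ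
    obtain ⟨hXi, hCX⟩ := (torsionfreeModule_succ_iff hgX (LinearMap.exact_map_mkQ_range gX)
      (Submodule.mkQ_surjective _) _).1 hX
    obtain ⟨hYi, hCY⟩ := (torsionfreeModule_succ_iff hgY (LinearMap.exact_map_mkQ_range gY)
      (Submodule.mkQ_surjective _) _).1 hY
    refine (torsionfreeModule_succ_iff hgZ (LinearMap.exact_map_mkQ_range gZ)
      (Submodule.mkQ_surjective _) _).2
      ⟨?_, ih hC hCX hCY inferInstance inferInstance inferInstance⟩
    -- It remains to see that `gZ` is injective.
    rw [injective_iff_map_eq_zero]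
    intro z hz
    obtain ⟨y, rfl⟩ := h.surjective z
    have hy2 : (gY y).2 = 0 := (hq1 y).trans hz
    -- The first coordinate of `gY y` dies in the cokernel of `gY`, hence in that of `gX`.
    have h0 : (LinearMap.range gX).mkQ (gY y).1 = 0 := by
      refine hC.dualSurjective.injective hCX (Eq.trans ?_ (map_zero _).symm)
      refine (Submodule.Quotient.mk_eq_zero _).2 ⟨y, Prod.ext rfl hy2⟩
    obtain ⟨x, hx⟩ := (Submodule.Quotient.mk_eq_zero _).1 h0
    have hxy : i x = y := hYi ((hi1 x).trans (Prod.ext hx hy2.symm))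
    rw [← hxy]
    exact h.exact.apply_apply_eq_zero x

end DualExact

section Coresolution

variable {S : Type u} [Ring S]

/-! ### Gorenstein projective modules are `k`-torsionfree for all `k` -/

/-- `M` has a coresolution `0 → M → X⁰ → ⋯ → Xᵏ⁻¹` by projective modules, not necessarily finitely
generated, that stays exact under `Hom_S(-, Q)` for every projective module `Q`. -/
def HasProjCoresolution : ℕ → ModuleCat.{u} S → Prop
  | 0, _ => True
  | k + 1, M => ∃ (X C : ModuleCat.{u} S) (i : M →ₗ[S] X) (q : X →ₗ[S] C),
      Module.Projective S X ∧ Function.Injective i ∧ Function.Exact i q ∧ Function.Surjective q ∧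
      (∀ (Q : Type u) [AddCommGroup Q] [Module S Q], Module.Projective S Q →
        ∀ a : M →ₗ[S] Q, ∃ b : X →ₗ[S] Q, b ∘ₗ i = a) ∧ HasProjCoresolution k C

theorem HasProjCoresolution.of_equiv {k : ℕ} {M N : ModuleCat.{u} S}
    (h : HasProjCoresolution k M) (e : M ≃ₗ[S] N) : HasProjCoresolution k N := by
  cases k with
  | zero => trivial
  | succ k =>
    obtain ⟨X, C, i, q, hX, hi, hex, hq, hQ, hC⟩ := h
    refine ⟨X, C, i ∘ₗ e.symm, q, hX, hi.comp e.symm.injective,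
      e.symm.surjective.comp_exact_iff_exact.2 hex, hq, fun Q _ _ hPQ a => ?_, hC⟩
    obtain ⟨b, hb⟩ := hQ Q hPQ (a ∘ₗ e)
    refine ⟨b, ?_⟩
    rw [← LinearMap.comp_assoc, hb, LinearMap.comp_assoc, LinearEquiv.comp_symm, LinearMap.comp_id]

theorem HasProjCoresolution.prod_projective {k : ℕ} {M : ModuleCat.{u} S}
    (h : HasProjCoresolution k M) (P : Type u) [AddCommGroup P] [Module S P]
    [Module.Projective S P] : HasProjCoresolution k (ModuleCat.of S (M × P)) := by
  cases k with
  | zero => trivial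
  | succ k =>
    obtain ⟨X, C, i, q, hX, hi, hex, hq, hQ, hC⟩ := h
    refine ⟨ModuleCat.of S (X × P), C, i.prodMap LinearMap.id, q ∘ₗ .fst S X P,
      inferInstanceAs (Module.Projective S (X × P)), hi.prodMap Function.injective_id, ?_,
      hq.comp Prod.fst_surjective, fun Q _ _ hPQ a => ?_, hC⟩
    · rintro ⟨x, p⟩
      refine (hex x).trans ⟨?_, ?_⟩
      · rintro ⟨m, rfl⟩
        exact ⟨(m, p), rfl⟩
      · rintro ⟨⟨m, p'⟩, h⟩
        exact ⟨m, congrArg Prod.fst h⟩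
    · obtain ⟨b, hb⟩ := hQ Q hPQ (a ∘ₗ .inl S M P)
      refine ⟨b.coprod (a ∘ₗ .inr S M P), ?_⟩
      ext m
      · have h1 : b (i m) = a (m, 0) := LinearMap.congr_fun hb m
        have h2 : a (0, 0) = 0 := map_zero a
        simp [h1, h2]
      · simp

/-- Projective direct summands can be cancelled. -/
theorem HasProjCoresolution.of_prod {k : ℕ} {M : ModuleCat.{u} S} (P : Type u) [AddCommGroup P]
    [Module S P] [Module.Projective S P] (h : HasProjCoresolution k (ModuleCat.of S (M × P))) :
    HasProjCoresolution k M := by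
  cases k with
  | zero => trivial
  | succ k =>
    obtain ⟨X, C, i, q, hX, hi, hex, hq, hQ, hC⟩ := h
    -- The projection `M × P → P` extends to `r : X → P`, and the cokernel of `M → X` is `C × P`.
    obtain ⟨r, hr⟩ := hQ P inferInstance (.snd S M P)
    have hr' : ∀ m p, r (i (m, p)) = p := fun m p => LinearMap.congr_fun hr (m, p)
    have hqi : ∀ m, q (i m) = 0 := hex.apply_apply_eq_zero
    refine ⟨X, ModuleCat.of S (C × P), i ∘ₗ .inl S M P, q.prod r, hX,
      hi.comp LinearMap.inl_injective, ?_, ?_, fun Q _ _ hPQ a => ?_, hC.prod_projective P⟩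
    · intro x
      constructor
      · intro hx
        obtain ⟨⟨m, p⟩, rfl⟩ := (hex x).1 (congrArg Prod.fst hx)
        have hp : p = 0 := (hr' m p).symm.trans (congrArg Prod.snd hx)
        exact ⟨m, by rw [hp]; rfl⟩
      · rintro ⟨m, rfl⟩
        exact Prod.ext (hqi _) (hr' m 0)
    · rintro ⟨c, p⟩
      obtain ⟨x, rfl⟩ := hq c
      refine ⟨x + i (0, p - r x), Prod.ext ?_ ?_⟩
      · change q _ = _
        rw [map_add, hqi, add_zero]
      · change r _ = p
        rw [map_add, hr', add_sub_cancel]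
    · obtain ⟨b, hb⟩ := hQ Q hPQ (a ∘ₗ .fst S M P)
      refine ⟨b, ?_⟩
      rw [← LinearMap.comp_assoc, hb]
      rfl

theorem HasProjCoresolution.pi {k : ℕ} {M : ModuleCat.{u} S} (h : HasProjCoresolution k M)
    (n : ℕ) : HasProjCoresolution k (ModuleCat.of S (Fin n → M)) := by
  induction k generalizing M with
  | zero => trivial
  | succ k ih =>
    obtain ⟨X, C, i, q, hX, hi, hex, hq, hQ, hC⟩ := h
    refine ⟨ModuleCat.of S (Fin n → X), ModuleCat.of S (Fin n → C), i.compLeft (Fin n),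
      q.compLeft (Fin n), ?_, hi.comp_left, ?_, hq.comp_left, fun Q _ _ hPQ a => ?_, ih hC⟩
    · exact Module.Projective.of_equiv
        (DFinsupp.linearEquivFunOnFintype (ι := Fin n) (R := S) (M := fun _ => X))
    · intro x
      refine funext_iff.trans ((forall_congr' fun j => hex (x j)).trans ⟨fun hx => ?_, ?_⟩)
      · choose m hm using hx
        exact ⟨m, funext hm⟩
      · rintro ⟨m, rfl⟩ j
        exact ⟨m j, rfl⟩
    · choose b hb using fun j => hQ Q hPQ (a ∘ₗ LinearMap.single S (fun _ : Fin n => M) j)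
      refine ⟨∑ j, b j ∘ₗ LinearMap.proj j, LinearMap.ext fun m => ?_⟩
      have h1 : ∀ j, b j (i (m j)) = a (Pi.single j (m j)) :=
        fun j => LinearMap.congr_fun (hb j) (m j)
      rw [← Finset.univ_sum_single m, map_sum a, Finset.univ_sum_single m, LinearMap.comp_apply,
        LinearMap.sum_apply]
      exact Finset.sum_congr rfl fun j _ => h1 j

/-- Comparing with a left approximation by a finitely generated projective module (Schanuel's
argument), a finitely generated module with a coresolution by arbitrary projective modules also
has one by finitely generated ones. -/
theorem HasProjCoresolution.torsionfree [IsNoetherianRing S] [IsNoetherianRing Sᵐᵒᵖ] {k : ℕ}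
    {M : ModuleCat.{u} S} [Module.Finite S M] (h : HasProjCoresolution k M) :
    TorsionfreeModule S k M := by
  induction k generalizing M with
  | zero => exact torsionfreeModule_zero_iff.2 inferInstance
  | succ k ih =>
    obtain ⟨X, C, i, q, hX, hi, hex, hq, hQ, hC⟩ := h
    obtain ⟨n, g, hg⟩ := exists_dualSurjective (S := S) M
    obtain ⟨v, hv⟩ := hg.exists_extend i
    obtain ⟨w, hw⟩ := hQ (Fin n → S) inferInstance g
    have hv' : ∀ m, v (g m) = i m := LinearMap.congr_fun hv
    have hw' : ∀ m, w (i m) = g m := LinearMap.congr_fun hw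
    have hgi : Function.Injective g := by
      refine Function.Injective.of_comp (f := v) ?_
      rwa [← LinearMap.coe_comp, hv]
    refine (torsionfreeModule_succ_iff hg (LinearMap.exact_map_mkQ_range g)
      (Submodule.mkQ_surjective _) k).2 ⟨hgi, ?_⟩
    -- `C ⊕ Sⁿ` and `Sⁿ / M ⊕ X` are quotients of `X ⊕ Sⁿ` by the same submodule: both maps have
    -- kernel `{(i m, g m)}`.
    let a : X × (Fin n → S) →ₗ[S] C × (Fin n → S) :=
      (q ∘ₗ .fst S _ _).prod (.snd S _ _ - w ∘ₗ .fst S _ _)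
    let b : X × (Fin n → S) →ₗ[S] ((Fin n → S) ⧸ LinearMap.range g) × X :=
      ((LinearMap.range g).mkQ ∘ₗ .snd S _ _).prod (.fst S _ _ - v ∘ₗ .snd S _ _)
    have ha : Function.Surjective a := by
      rintro ⟨c, p⟩
      obtain ⟨x, rfl⟩ := hq c
      exact ⟨(x, p + w x), by simp [a]⟩
    have hb : Function.Surjective b := by
      rintro ⟨c, x⟩
      obtain ⟨p, rfl⟩ := Submodule.mkQ_surjective _ c
      exact ⟨(x + v p, p), by simp [b]⟩
    have hab : LinearMap.ker a = LinearMap.ker b := by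
      ext ⟨x, p⟩
      simp only [LinearMap.mem_ker]
      constructor
      · intro h0
        obtain ⟨m, rfl⟩ := (hex x).1 (congrArg Prod.fst h0)
        have hp : p = g m := by
          rw [← hw' m]
          exact sub_eq_zero.1 (congrArg Prod.snd h0)
        rw [hp]
        exact Prod.ext ((Submodule.Quotient.mk_eq_zero _).2 ⟨m, rfl⟩)
          (sub_eq_zero.2 (hv' m).symm)
      · intro h0
        obtain ⟨m, rfl⟩ := (Submodule.Quotient.mk_eq_zero _).1 (congrArg Prod.fst h0)
        have hx : x = i m := by
          rw [← hv' m]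
          exact sub_eq_zero.1 (congrArg Prod.snd h0)
        rw [hx]
        exact Prod.ext (hex.apply_apply_eq_zero m) (sub_eq_zero.2 (hw' m).symm)
    let e := (a.quotKerEquivOfSurjective ha).symm.trans
      ((Submodule.quotEquivOfEq _ _ hab).trans (b.quotKerEquivOfSurjective hb))
    exact ih (M := ModuleCat.of S _) (HasProjCoresolution.of_prod X
      ((hC.prod_projective (Fin n → S)).of_equiv (N := ModuleCat.of S _) e))

/-- The right half of the complex is a coresolution of the image of each differential. -/
theorem TotallyAcyclicComplex.hasProjCoresolution (P : TotallyAcyclicComplex S) (k : ℕ) (j : ℤ) :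
    HasProjCoresolution k (ModuleCat.of S (LinearMap.range (P.d j))) := by
  induction k generalizing j with
  | zero => trivial
  | succ k ih =>
    obtain ⟨j, rfl⟩ : ∃ j', j = j' + 1 := ⟨j - 1, by omega⟩
    refine ⟨P.X (j + 1), ModuleCat.of S (LinearMap.range (P.d j)),
      (LinearMap.range (P.d (j + 1))).subtype, (P.d j).rangeRestrict, P.projective _,
      Subtype.val_injective, ?_, LinearMap.surjective_rangeRestrict _, fun Q _ _ hQ a => ?_, ih j⟩
    · intro x
      refine Subtype.ext_iff.trans ((P.exact j x).trans ?_)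
      rw [Set.mem_range, Submodule.coe_subtype, Subtype.range_coe]
      rfl
    · obtain ⟨b, hb⟩ := (P.exact_hom Q hQ (j + 1) (a ∘ₗ (P.d (j + 1)).rangeRestrict)).1 (by
        ext x
        have h0 : (P.d (j + 1)).rangeRestrict (P.d (j + 1 + 1) x) = 0 :=
          Subtype.ext ((P.exact (j + 1)).apply_apply_eq_zero x)
        simp [h0])
      refine ⟨b, LinearMap.ext ?_⟩
      rintro ⟨_, x, rfl⟩
      exact LinearMap.congr_fun hb x

theorem IsGorensteinProjective.hasProjCoresolution {M : ModuleCat.{u} S}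
    (h : IsGorensteinProjective S M) (k : ℕ) : HasProjCoresolution k M := by
  obtain ⟨P, ⟨e⟩⟩ := h
  exact (P.hasProjCoresolution k 0).of_equiv e.symm

end Coresolution

section Restriction

variable {R A : Type u} [Ring R] [Ring A] (φ : R →+* A)

/-! ### Restriction of scalars along a finite ring homomorphism -/

/-- An `A`-linear map as an `R`-linear map. -/
def resMap {M N : ModuleCat.{u} A} (g : M →ₗ[A] N) :
    (ModuleCat.restrictScalars φ).obj M →ₗ[R] (ModuleCat.restrictScalars φ).obj N :=
  ((ModuleCat.restrictScalars φ).map (ModuleCat.ofHom g)).hom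

/-- An `A`-submodule as an `R`-submodule. -/
def resSubmodule {M : ModuleCat.{u} A} (N : Submodule A M) :
    Submodule R ((ModuleCat.restrictScalars φ).obj M) where
  toAddSubmonoid := N.toAddSubmonoid
  smul_mem' r _ hx := N.smul_mem (φ r) hx

theorem isNoetherian_of_restrictScalars (M : ModuleCat.{u} A)
    [h : IsNoetherian R ((ModuleCat.restrictScalars φ).obj M)] : IsNoetherian A M := by
  rw [isNoetherian_iff'] at h ⊢
  have hs : StrictMono (resSubmodule φ (M := M)) := fun _ _ hNN => hNN
  exact hs.wellFoundedGT

/-- A finite extension of a two-sided noetherian ring is two-sided noetherian. -/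
theorem isNoetherianRing_of_isFiniteHom [IsNoetherianRing R] [IsNoetherianRing Rᵐᵒᵖ]
    (hfin : IsFiniteHom φ) : IsNoetherianRing A ∧ IsNoetherianRing Aᵐᵒᵖ := by
  have := hfin.1
  have := hfin.2
  have h2 : IsNoetherian Aᵐᵒᵖ A :=
    isNoetherian_of_restrictScalars (RingHom.op φ) (ModuleCat.of Aᵐᵒᵖ A)
  exact ⟨isNoetherian_of_restrictScalars φ (ModuleCat.of A A),
    isNoetherian_of_linearEquiv (opLinearEquiv Aᵐᵒᵖ (M := A))⟩

/-- Restriction of scalars commutes with finite powers. -/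
def resPiEquiv (n : ℕ) : (Fin n → leftModuleVia φ) ≃ₗ[R]
    (ModuleCat.restrictScalars φ).obj (ModuleCat.of A (Fin n → A)) where
  toFun a := a
  invFun a := a
  map_add' _ _ := rfl
  map_smul' _ _ := rfl

theorem finite_restrictScalars_iff (hfin : IsFiniteHom φ) (M : ModuleCat.{u} A) :
    Module.Finite R ((ModuleCat.restrictScalars φ).obj M) ↔ Module.Finite A M := by
  constructor
  · rintro ⟨s, hs⟩
    let t : Finset M := s
    refine ⟨t, eq_top_iff.2 fun x _ => ?_⟩
    have h1 : Submodule.span R (s : Set ((ModuleCat.restrictScalars φ).obj M)) ≤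
        resSubmodule φ (Submodule.span A (t : Set M)) :=
      Submodule.span_le.2 fun y hy => Submodule.subset_span (R := A) (M := M) hy
    exact h1 (hs ▸ Submodule.mem_top)
  · intro h
    have := hfin.1
    obtain ⟨n, s, hs⟩ := Module.Finite.exists_fin' A M
    exact Module.Finite.of_surjective
      ((resMap φ (M := ModuleCat.of A (Fin n → A)) s) ∘ₗ (resPiEquiv φ n).toLinearMap)
      (hs.comp (resPiEquiv φ n).surjective)

/-- If `Hom_R(A, R)` is a projective `A`-module, an `A`-approximation is an `R`-approximation, since
`Hom_R(M, R) = Hom_A(M, Hom_R(A, R))`. -/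
theorem DualSurjective.restrictScalars
    (hproj : Module.Projective A ((ModuleCat.coextendScalars φ).obj (ModuleCat.of R R)))
    {M P : ModuleCat.{u} A} [Module.Finite A M] {g : M →ₗ[A] P} (hg : DualSurjective g) :
    DualSurjective (M := (ModuleCat.restrictScalars φ).obj M)
      (P := (ModuleCat.restrictScalars φ).obj P) (resMap φ g) := by
  intro α
  obtain ⟨v, hv⟩ := hg.exists_extend
    (ModuleCat.RestrictionCoextensionAdj.HomEquiv.fromRestriction φ (X := ModuleCat.of R R)
      (ModuleCat.ofHom (X := (ModuleCat.restrictScalars φ).obj M) α)).hom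
  refine ⟨(ModuleCat.RestrictionCoextensionAdj.HomEquiv.toRestriction φ (X := ModuleCat.of R R)
      (ModuleCat.ofHom v)).hom, LinearMap.ext fun m => ?_⟩
  have h1 := LinearMap.congr_fun (LinearMap.congr_fun hv m) (1 : A)
  refine h1.trans ?_
  exact congrArg α (one_smul A (show M from m))

/-- A finitely generated `A`-module is `k`-torsionfree over `A` if and only if it is
`k`-torsionfree over `R`. -/
theorem torsionfreeModule_restrictScalars_iff [IsNoetherianRing R] [IsNoetherianRing Rᵐᵒᵖ]
    (hfin : IsFiniteHom φ) (hGp : IsGorensteinProjective R (leftModuleVia φ))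
    (hproj : Module.Projective A ((ModuleCat.coextendScalars φ).obj (ModuleCat.of R R)))
    (k : ℕ) (M : ModuleCat.{u} A) :
    kTorsionfree R k ((ModuleCat.restrictScalars φ).obj M) ↔ kTorsionfree A k M := by
  have hA := isNoetherianRing_of_isFiniteHom φ hfin
  have := hA.1
  have := hA.2
  have hf := finite_restrictScalars_iff φ hfin
  induction k generalizing M with
  | zero =>
    exact (torsionfreeModule_zero_iff (M := (ModuleCat.restrictScalars φ).obj M)).trans
      ((hf M).trans torsionfreeModule_zero_iff.symm)
  | succ k ih =>
    by_cases hM : Module.Finite A M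
    swap
    · exact iff_of_false (fun h => hM ((hf M).1 h.1)) (fun h => hM h.1)
    have hMR := (hf M).2 hM
    obtain ⟨n, g, hg⟩ := exists_dualSurjective (S := A) M
    have hgR := DualSurjective.restrictScalars φ hproj (P := ModuleCat.of A (Fin n → A)) hg
    -- `Aⁿ` is Gorenstein projective over `R`.
    have hP : ∀ j, TorsionfreeModule R j
        ((ModuleCat.restrictScalars φ).obj (ModuleCat.of A (Fin n → A))) := fun j => by
      have := (hf (ModuleCat.of A (Fin n → A))).2 (inferInstanceAs (Module.Finite A (Fin n → A)))
      exact (((hGp.hasProjCoresolution j).pi n).of_equiv (resPiEquiv φ n)).torsionfree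
    have hC : DualExact (X := (ModuleCat.restrictScalars φ).obj M)
        (Y := (ModuleCat.restrictScalars φ).obj (ModuleCat.of A (Fin n → A)))
        (Z := (ModuleCat.restrictScalars φ).obj (ModuleCat.of A _))
        (resMap φ (N := ModuleCat.of A (Fin n → A)) g)
        (resMap φ (M := ModuleCat.of A (Fin n → A)) (N := ModuleCat.of A _)
          (LinearMap.range g).mkQ) :=
      ⟨LinearMap.exact_map_mkQ_range g, Submodule.mkQ_surjective (LinearMap.range g), hgR⟩
    refine Iff.trans ?_ (torsionfreeModule_succ_iff hg (LinearMap.exact_map_mkQ_range g)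
      (Submodule.mkQ_surjective _) k).symm
    refine Iff.trans ?_ (and_congr_right' (ih (ModuleCat.of A _)))
    exact ⟨fun h => ⟨DualSurjective.injective (S := R)
          (X := (ModuleCat.restrictScalars φ).obj M)
          (Y := (ModuleCat.restrictScalars φ).obj (ModuleCat.of A (Fin n → A))) hgR h,
        torsionfree_right (S := R) (X := (ModuleCat.restrictScalars φ).obj M)
          (Y := (ModuleCat.restrictScalars φ).obj (ModuleCat.of A (Fin n → A)))
          (Z := (ModuleCat.restrictScalars φ).obj (ModuleCat.of A _)) k hC h (hP k)⟩,
      fun h => torsionfree_left (S := R) (X := (ModuleCat.restrictScalars φ).obj M)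
        (Y := (ModuleCat.restrictScalars φ).obj (ModuleCat.of A (Fin n → A)))
        (Z := (ModuleCat.restrictScalars φ).obj (ModuleCat.of A _)) k hC h.1 (hP (k + 1)) h.2⟩

end Restriction

section BalancedTensor

variable {R : Type u} [Ring R] {N N' N'' M M' M'' : Type u} [AddCommGroup N] [Module Rᵐᵒᵖ N]
  [AddCommGroup N'] [Module Rᵐᵒᵖ N'] [AddCommGroup N''] [Module Rᵐᵒᵖ N'']
  [AddCommGroup M] [Module R M] [AddCommGroup M'] [Module R M'] [AddCommGroup M''] [Module R M'']

/-! ### Tensor products over a noncommutative ring -/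

namespace BalancedTensor

variable (R) in
/-- The pure tensor `n ⊗ m` in `N ⊗_R M`. -/
def tmul (n : N) (m : M) : BalancedTensor R N M :=
  QuotientAddGroup.mk (n ⊗ₜ[ℤ] m)

theorem tmul_add (n : N) (m m' : M) : tmul R n (m + m') = tmul R n m + tmul R n m' :=
  congrArg (QuotientAddGroup.mk' (balancedRelations R N M)) (TensorProduct.tmul_add n m m')

theorem add_tmul (n n' : N) (m : M) : tmul R (n + n') m = tmul R n m + tmul R n' m :=
  congrArg (QuotientAddGroup.mk' (balancedRelations R N M)) (TensorProduct.add_tmul n n' m)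

theorem smul_tmul (r : R) (n : N) (m : M) : tmul R (op r • n) m = tmul R n (r • m) := by
  refine (QuotientAddGroup.eq_iff_sub_mem).2 (AddSubgroup.subset_closure ⟨n, r, m, rfl⟩)

variable (R) in
/-- The biadditive map `(n, m) ↦ n ⊗ m`. -/
def mk : N →+ M →+ BalancedTensor R N M :=
  AddMonoidHom.mk' (fun n => AddMonoidHom.mk' (tmul R n) (tmul_add n))
    fun n n' => AddMonoidHom.ext (add_tmul n n')

@[simp] theorem mk_apply (n : N) (m : M) : mk R n m = tmul R n m := rfl

@[elab_as_elim]
theorem induction_on {p : BalancedTensor R N M → Prop} (x : BalancedTensor R N M)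
    (zero : p 0) (tmul : ∀ n m, p (tmul R n m)) (add : ∀ x y, p x → p y → p (x + y)) : p x := by
  obtain ⟨x, rfl⟩ := QuotientAddGroup.mk_surjective x
  induction x using TensorProduct.induction_on with
  | zero => exact zero
  | tmul n m => exact tmul n m
  | add x y hx hy => exact add _ _ hx hy

/-- The additive map out of `N ⊗_R M` attached to a balanced biadditive map. -/
def lift {G : Type*} [AddCommGroup G] (f : N →+ M →+ G)
    (hf : ∀ (r : R) n m, f (op r • n) m = f n (r • m)) : BalancedTensor R N M →+ G :=
  QuotientAddGroup.lift _ (TensorProduct.liftAddHom f fun r n m => by simp) (by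
    refine (AddSubgroup.closure_le _).2 ?_
    rintro _ ⟨n, r, m, rfl⟩
    refine AddMonoidHom.mem_ker.2 ?_
    rw [map_sub, TensorProduct.liftAddHom_tmul, TensorProduct.liftAddHom_tmul, hf, sub_self])

@[simp] theorem lift_tmul {G : Type*} [AddCommGroup G] (f : N →+ M →+ G)
    (hf : ∀ (r : R) n m, f (op r • n) m = f n (r • m)) (n : N) (m : M) :
    lift f hf (tmul R n m) = f n m := rfl

@[simp] theorem map_tmul (f : N →ₗ[Rᵐᵒᵖ] N') (g : M →ₗ[R] M') (n : N) (m : M) :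
    map f g (tmul R n m) = tmul R (f n) (g m) := rfl

theorem map_map (f : N →ₗ[Rᵐᵒᵖ] N') (g : M →ₗ[R] M') (f' : N' →ₗ[Rᵐᵒᵖ] N'') (g' : M' →ₗ[R] M'')
    (x : BalancedTensor R N M) : map f' g' (map f g x) = map (f' ∘ₗ f) (g' ∘ₗ g) x := by
  induction x using induction_on with
  | zero => simp only [map_zero]
  | tmul n m => rfl
  | add x y hx hy => simp only [map_add, hx, hy]

/-- `N ⊗_R -` is right exact. The inverse of `N ⊗ M' / im → N ⊗ M''` sends `n ⊗ g m` to the class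
of `n ⊗ m`. -/
theorem exact_map_right (N : Type u) [AddCommGroup N] [Module Rᵐᵒᵖ N] {f : M →ₗ[R] M'}
    {g : M' →ₗ[R] M''} (hex : Function.Exact f g) (hg : Function.Surjective g) :
    Function.Exact (map (LinearMap.id : N →ₗ[Rᵐᵒᵖ] N) f) (map (LinearMap.id : N →ₗ[Rᵐᵒᵖ] N) g) := by
  let φ := QuotientAddGroup.mk' (map (LinearMap.id : N →ₗ[Rᵐᵒᵖ] N) f).range
  have key : ∀ n m m', g m = g m' → φ (tmul R n m) = φ (tmul R n m') := by
    intro n m m' h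
    obtain ⟨y, hy⟩ := (hex (m - m')).1 (by rw [map_sub, h, sub_self])
    have h1 : φ (mk R n (m - m')) = 0 :=
      (QuotientAddGroup.eq_zero_iff _).2 ⟨tmul R n y, by simp [hy]⟩
    rw [map_sub, map_sub, sub_eq_zero] at h1
    exact h1
  let s := Function.surjInv hg
  have hs : ∀ m, g (s m) = m := Function.surjInv_eq hg
  let ψ : BalancedTensor R N M'' →+ BalancedTensor R N M' ⧸ _ :=
    lift (AddMonoidHom.mk' (fun n => AddMonoidHom.mk' (fun m => φ (tmul R n (s m)))
        fun m m' => by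
          rw [← map_add, ← tmul_add]
          exact key _ _ _ (by simp [hs]))
        fun n n' => by
          ext m
          simp [add_tmul])
      (fun r n m => by
        change φ (tmul R (op r • n) (s m)) = φ (tmul R n (s (r • m)))
        rw [smul_tmul]
        exact key _ _ _ (by simp [hs]))
  have hψ : ∀ x, ψ (map LinearMap.id g x) = φ x := by
    intro x
    induction x using induction_on with
    | zero => simp only [map_zero]
    | tmul n m => exact key _ _ _ (hs _)
    | add x y hx hy => simp only [map_add, hx, hy]
  intro x
  constructor
  · intro hx
    exact (QuotientAddGroup.eq_zero_iff x).1 ((hψ x).symm.trans (by rw [hx, map_zero]))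
  · rintro ⟨y, rfl⟩
    rw [map_map, hex.linearMap_comp_eq_zero]
    induction y using induction_on with
    | zero => simp only [map_zero]
    | tmul n m => exact map_zero (mk R n)
    | add x y hx hy => simp only [map_add, hx, hy, add_zero]

/-- `- ⊗_R M` is right exact: exactness in the middle. -/
theorem exists_of_map_left_eq_zero (M : Type u) [AddCommGroup M] [Module R M] {f : N →ₗ[Rᵐᵒᵖ] N'}
    {g : N' →ₗ[Rᵐᵒᵖ] N''} (hex : Function.Exact f g) (hg : Function.Surjective g)
    {x : BalancedTensor R N' M} (hx : map g (LinearMap.id : M →ₗ[R] M) x = 0) :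
    ∃ y, map f (LinearMap.id : M →ₗ[R] M) y = x := by
  let φ := QuotientAddGroup.mk' (map f (LinearMap.id : M →ₗ[R] M)).range
  have key : ∀ n n' m, g n = g n' → φ (tmul R n m) = φ (tmul R n' m) := by
    intro n n' m h
    obtain ⟨y, hy⟩ := (hex (n - n')).1 (by rw [map_sub, h, sub_self])
    have h1 : φ (mk R (n - n') m) = 0 :=
      (QuotientAddGroup.eq_zero_iff _).2 ⟨tmul R y m, by
      rw [map_tmul, hy]
      rfl⟩
    rw [map_sub, AddMonoidHom.sub_apply, map_sub, sub_eq_zero] at h1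
    exact h1
  let s := Function.surjInv hg
  have hs : ∀ m, g (s m) = m := Function.surjInv_eq hg
  let ψ : BalancedTensor R N'' M →+ BalancedTensor R N' M ⧸ _ :=
    lift (AddMonoidHom.mk' (fun n => AddMonoidHom.mk' (fun m => φ (tmul R (s n) m))
        fun m m' => by
          rw [← map_add, ← tmul_add])
        fun n n' => by
          ext m
          change φ _ = φ _ + φ _
          rw [← map_add, ← add_tmul]
          exact key _ _ _ (by simp [hs]))
      (fun r n m => by
        change φ (tmul R (s (op r • n)) m) = φ (tmul R (s n) (r • m))
        rw [← smul_tmul]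
        exact key _ _ _ (by simp [hs]))
  have hψ : ∀ x, ψ (map g LinearMap.id x) = φ x := by
    intro x
    induction x using induction_on with
    | zero => simp only [map_zero]
    | tmul n m => exact key _ _ _ (hs _)
    | add x y hx hy => simp only [map_add, hx, hy]
  exact (QuotientAddGroup.eq_zero_iff x).1 ((hψ x).symm.trans (by rw [hx, map_zero]))

theorem map_right_surjective (N : Type u) [AddCommGroup N] [Module Rᵐᵒᵖ N] {g : M →ₗ[R] M'}
    (hg : Function.Surjective g) :
    Function.Surjective (map (LinearMap.id : N →ₗ[Rᵐᵒᵖ] N) g) := by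
  intro x
  induction x using induction_on with
  | zero => exact ⟨0, map_zero _⟩
  | tmul n m =>
    obtain ⟨m, rfl⟩ := hg m
    exact ⟨tmul R n m, rfl⟩
  | add x y hx hy =>
    obtain ⟨x, rfl⟩ := hx
    obtain ⟨y, rfl⟩ := hy
    exact ⟨x + y, map_add _ _ _⟩

end BalancedTensor

/-! ### The equational criterion for flatness -/

open BalancedTensor in
/-- Every map from a finitely generated module `M` over a left noetherian ring to a flat module `F`
factors through a projective module. A presentation `Rᵇ → Rᵃ → M → 0` makes the map an element of
`Rᵃ ⊗ F` killed by the transposed matrix `Rᵃ → Rᵇ` of right modules; by flatness it comes from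
`K ⊗ F`, where `K` is the kernel of the matrix, that is `K = Hom_R(M, R)`. -/
theorem IsFlatLeft.exists_factorization [IsNoetherianRing R] {F : Type u} [AddCommGroup F]
    [Module R F] (hF : IsFlatLeft R F) [Module.Finite R M] (u : M →ₗ[R] F) :
    ∃ (Q : ModuleCat.{u} R) (κ : M →ₗ[R] Q) (v : Q →ₗ[R] F),
      Module.Projective R Q ∧ v ∘ₗ κ = u := by
  obtain ⟨a, π, hπ⟩ := Module.Finite.exists_fin' R M
  obtain ⟨b, ρ', hρ'⟩ := Module.Finite.exists_fin' R (LinearMap.ker π)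
  let ρ := (LinearMap.ker π).subtype ∘ₗ ρ'
  have hex : Function.Exact ρ π := hρ'.comp_exact_iff_exact.2 (LinearMap.exact_subtype_ker_map π)
  let e : Fin a → Fin a → R := fun i => Pi.single i 1
  let e' : Fin b → Fin b → R := fun i => Pi.single i 1
  let d : (Fin a → R) →ₗ[Rᵐᵒᵖ] (Fin b → R) :=
    { toFun := fun k j => ∑ i, ρ (e' j) i * k i
      map_add' := fun k l => by ext j; simp [mul_add, Finset.sum_add_distrib]
      map_smul' := fun r k => by ext j; simp [Finset.sum_mul, mul_assoc] }
  let x : BalancedTensor R (Fin a → R) F := ∑ i, tmul R (e i) (u (π (e i)))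
  have hx : map d (LinearMap.id : F →ₗ[R] F) x = 0 := by
    have hd : ∀ i, d (e i) = ∑ j, op (ρ (e' j) i) • e' j := by
      intro i
      ext j
      simp [d, e, e', Pi.single_apply]
    have hρ : ∀ j, ∑ i, ρ (e' j) i • u (π (e i)) = 0 := by
      intro j
      have h0 : u (π (ρ (e' j))) = 0 := by rw [hex.apply_apply_eq_zero, map_zero]
      conv_lhs at h0 => rw [pi_eq_sum_univ' (ρ (e' j))]
      simpa only [map_sum, map_smul] using h0
    have h1 : ∀ i, map d (LinearMap.id : F →ₗ[R] F) (tmul R (e i) (u (π (e i)))) =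
        ∑ j, mk R (e' j) (ρ (e' j) i • u (π (e i))) := by
      intro i
      have h2 : map d (LinearMap.id : F →ₗ[R] F) (tmul R (e i) (u (π (e i)))) =
        mk R (d (e i)) (u (π (e i))) := rfl
      rw [h2, hd, map_sum, AddMonoidHom.finsetSum_apply]
      exact Finset.sum_congr rfl fun j _ => smul_tmul _ _ _
    rw [map_sum, Finset.sum_congr rfl fun i _ => h1 i, Finset.sum_comm]
    refine Finset.sum_eq_zero fun j _ => ?_
    rw [← map_sum, hρ, map_zero]
  have hx' : map d.rangeRestrict (LinearMap.id : F →ₗ[R] F) x = 0 := by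
    refine hF _ _ (LinearMap.range d).subtype Subtype.val_injective ?_
    rw [map_map, map_zero]
    exact hx
  obtain ⟨z, hz⟩ := exists_of_map_left_eq_zero F (f := (LinearMap.ker d).subtype)
    (by
      intro k
      rw [Submodule.coe_subtype, Subtype.range_coe]
      exact Subtype.ext_iff)
    (LinearMap.surjective_rangeRestrict d) hx'
  let ev (i : Fin a) : BalancedTensor R (Fin a → R) F →+ F :=
    lift (AddMonoidHom.mk' (fun k => AddMonoidHom.mk' (fun f => k i • f) (smul_add _))
      fun k l => AddMonoidHom.ext fun f => add_smul _ _ f) fun r k f => mul_smul _ _ _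
  have hev : ∀ i, ev i x = u (π (e i)) := by
    intro i
    have h1 : ∀ j, ev i (tmul R (e j) (u (π (e j)))) = e j i • u (π (e j)) := fun _ => rfl
    rw [map_sum]
    simp only [h1]
    simp [e, Pi.single_apply]
  have key : ∀ z : BalancedTensor R (LinearMap.ker d) F,
      ∃ (Q : ModuleCat.{u} R) (κ : M →ₗ[R] Q) (v : Q →ₗ[R] F), Module.Projective R Q ∧
        ∀ i, v (κ (π (e i))) = ev i (map (LinearMap.ker d).subtype LinearMap.id z) := by
    intro z
    induction z using BalancedTensor.induction_on with
    | zero =>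
      exact ⟨ModuleCat.of R R, 0, 0, inferInstanceAs (Module.Projective R R), fun i => by simp⟩
    | tmul k f =>
      let α : (Fin a → R) →ₗ[R] R := ∑ i, (LinearMap.proj i).smulRight (k.1 i)
      have hα : ∀ c, α c = ∑ i, c i * k.1 i := fun c => by simp [α, LinearMap.sum_apply]
      obtain ⟨κ, hκ⟩ := exists_comp_eq_of_exact hex hπ α (by
        refine LinearMap.pi_ext' fun j => LinearMap.ext_ring ?_
        exact (hα _).trans (congrFun (LinearMap.mem_ker.1 k.2) j))
      refine ⟨ModuleCat.of R R, κ, LinearMap.toSpanSingleton R F f,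
        inferInstanceAs (Module.Projective R R), fun i => ?_⟩
      have h1 : κ (π (e i)) = k.1 i := by
        refine (LinearMap.congr_fun hκ (e i)).trans ((hα _).trans ?_)
        simp [e, Pi.single_apply]
      rw [h1]
      rfl
    | add z w hz hw =>
      obtain ⟨Q, κ, v, hQ, h⟩ := hz
      obtain ⟨Q', κ', v', hQ', h'⟩ := hw
      refine ⟨ModuleCat.of R (Q × Q'), κ.prod κ', v.coprod v',
        inferInstanceAs (Module.Projective R (Q × Q')), fun i => ?_⟩
      rw [map_add, map_add, ← h, ← h']
      rfl
  obtain ⟨Q, κ, v, hQ, h⟩ := key z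
  refine ⟨Q, κ, v, hQ, ?_⟩
  have h1 : (v ∘ₗ κ) ∘ₗ π = u ∘ₗ π := by
    refine LinearMap.pi_ext' fun i => LinearMap.ext_ring ?_
    exact (h i).trans ((congrArg (ev i) hz).trans (hev i))
  exact LinearMap.ext fun m => by
    obtain ⟨y, rfl⟩ := hπ m
    exact LinearMap.congr_fun h1 y

end BalancedTensor

section Extension

open BalancedTensor

variable {A R : Type u} [Ring A] [Ring R] (T : Type u) [AddCommGroup T] [Module A T]
  [Module Rᵐᵒᵖ T] [SMulCommClass A Rᵐᵒᵖ T] {M M' M'' : Type u} [AddCommGroup M] [Module R M]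
  [AddCommGroup M'] [Module R M'] [AddCommGroup M''] [Module R M'']

/-! ### Extension of scalars along a bimodule -/

variable (R M) in
/-- The left `A`-module `T ⊗_R M` for an `A`-`R`-bimodule `T`. -/
def TensorModule : Type u := BalancedTensor R T M

instance : AddCommGroup (TensorModule R T M) :=
  inferInstanceAs (AddCommGroup (BalancedTensor R T M))

variable (A R) in
/-- Left multiplication by `a` as an endomorphism of the right `R`-module `T`. -/
def smulEnd (a : A) : T →ₗ[Rᵐᵒᵖ] T where
  toFun t := a • t
  map_add' := smul_add a
  map_smul' r t := smul_comm a r t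

instance : Module A (TensorModule R T M) where
  smul a := BalancedTensor.map (smulEnd A R T a) LinearMap.id
  one_smul x := by
    induction x using BalancedTensor.induction_on with
    | zero => exact map_zero _
    | tmul t m => exact congrArg (tmul R · m) (one_smul A t)
    | add x y hx hy => exact (map_add _ _ _).trans (congrArg₂ _ hx hy)
  mul_smul a b x := by
    induction x using BalancedTensor.induction_on with
    | zero => exact (map_zero _).trans (by
        change 0 = BalancedTensor.map _ _ (BalancedTensor.map _ _ 0)
        simp only [map_zero])
    | tmul t m => exact congrArg (tmul R · m) (mul_smul a b t)
    | add x y hx hy =>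
      refine (map_add _ _ _).trans ((congrArg₂ _ hx hy).trans ?_)
      change _ = BalancedTensor.map _ _ (BalancedTensor.map _ _ (x + y))
      simp only [map_add]
      rfl
  smul_zero a := map_zero _
  smul_add a := map_add _
  add_smul a b x := by
    induction x using BalancedTensor.induction_on with
    | zero =>
      exact (map_zero _).trans ((congrArg₂ _ (map_zero (BalancedTensor.map (smulEnd A R T a) _))
        (map_zero (BalancedTensor.map (smulEnd A R T b) _))).trans (add_zero _)).symm
    | tmul t m =>
      exact (congrArg (tmul R · m) (add_smul a b t)).trans (add_tmul _ _ _)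
    | add x y hx hy =>
      refine (map_add _ _ _).trans ((congrArg₂ _ hx hy).trans ?_)
      change _ = BalancedTensor.map _ _ (x + y) + BalancedTensor.map _ _ (x + y)
      simp only [map_add]
      exact add_add_add_comm _ _ _ _
  zero_smul x := by
    induction x using BalancedTensor.induction_on with
    | zero => exact map_zero _
    | tmul t m =>
      refine (congrArg (tmul R · m) (zero_smul A t)).trans ?_
      exact DFunLike.congr_fun (map_zero (mk R)) m
    | add x y hx hy => exact (map_add _ _ _).trans ((congrArg₂ _ hx hy).trans (add_zero _))

variable (R M) in
/-- Additive maps out of `T ⊗_R M` that are `A`-linear on pure tensors are `A`-linear. -/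
def TensorModule.linearMapOfTmul {G : Type*} [AddCommGroup G] [Module A G]
    (f : BalancedTensor R T M →+ G)
    (hf : ∀ (a : A) t m, f (tmul R (a • t) m) = a • f (tmul R t m)) :
    TensorModule R T M →ₗ[A] G where
  toFun := f
  map_add' := map_add f
  map_smul' a x := by
    induction x using BalancedTensor.induction_on with
    | zero =>
      refine (congrArg f (smul_zero (A := TensorModule R T M) a)).trans ((map_zero f).trans ?_)
      rw [RingHom.id_apply, map_zero, smul_zero]
    | tmul t m => exact hf a t m
    | add x y hx hy =>
      refine (congrArg f (smul_add (A := TensorModule R T M) a x y)).trans ?_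
      refine (map_add f _ _).trans ((congrArg₂ _ hx hy).trans ?_)
      rw [map_add, RingHom.id_apply, smul_add]

variable (A) in
/-- The `A`-linear map `T ⊗ g`. -/
def tensorMap (g : M →ₗ[R] M') : TensorModule R T M →ₗ[A] TensorModule R T M' :=
  TensorModule.linearMapOfTmul R T M (BalancedTensor.map LinearMap.id g) fun _ _ _ => rfl

theorem tensorMap_exact {f : M →ₗ[R] M'} {g : M' →ₗ[R] M''} (hex : Function.Exact f g)
    (hg : Function.Surjective g) : Function.Exact (tensorMap A T f) (tensorMap A T g) :=
  exact_map_right T hex hg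

theorem tensorMap_surjective {g : M →ₗ[R] M'} (hg : Function.Surjective g) :
    Function.Surjective (tensorMap A T g) :=
  map_right_surjective T hg

variable {T} in
/-- If `T ⊗ g` is injective then `T ⊗ ker g = 0`, as `T ⊗ ker g` is a submodule of `T ⊗ M`. -/
theorem IsFaithfullyFlatRight.tensorMap_injective_iff (hT : IsFaithfullyFlatRight R T)
    (g : M →ₗ[R] M') : Function.Injective (tensorMap A T g) ↔ Function.Injective g := by
  refine ⟨fun h => ?_, fun h => hT.1 _ _ g h⟩
  have h0 : Subsingleton (BalancedTensor R T (LinearMap.ker g)) := by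
    refine subsingleton_of_forall_eq 0 fun x => ?_
    refine hT.1 _ _ (LinearMap.ker g).subtype Subtype.val_injective (h ?_)
    rw [map_zero]
    refine Eq.trans ?_ (map_zero (tensorMap A T g)).symm
    refine (map_map _ _ _ _ x).trans ?_
    rw [LinearMap.comp_ker_subtype]
    induction x using BalancedTensor.induction_on with
    | zero => exact map_zero _
    | tmul t m => exact map_zero (mk R t)
    | add x y hx hy => exact (map_add _ _ _).trans ((congrArg₂ _ hx hy).trans (add_zero _))
  have := hT.2 _ h0
  exact LinearMap.ker_eq_bot.1 ((LinearMap.ker g).eq_bot_of_subsingleton)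

variable (R) in
/-- The map `T ⊗_R Rⁿ → Tⁿ`, `t ⊗ c ↦ (t c_j)_j`. -/
def tensorPiHom (n : ℕ) : BalancedTensor R T (Fin n → R) →+ (Fin n → T) :=
  lift (AddMonoidHom.mk' (fun t => AddMonoidHom.mk' (fun c j => op (c j) • t)
      fun c c' => funext fun j => add_smul (op (c j)) (op (c' j)) t)
      fun t t' => AddMonoidHom.ext fun _ => funext fun _ => smul_add _ t t')
    fun r t c => funext fun j => (mul_smul (op (c j)) (op r) t).symm

/-- `T ⊗_R Rⁿ ≃ Tⁿ`, as left `A`-modules. -/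
def tensorPiEquiv (n : ℕ) : TensorModule R T (Fin n → R) ≃ₗ[A] (Fin n → T) :=
  LinearEquiv.ofLinearMap
    (TensorModule.linearMapOfTmul R T (Fin n → R) (tensorPiHom R T n)
      fun a t c => funext fun j => (smul_comm a (op (c j)) t).symm)
    { toFun := fun x => ∑ j, tmul R (x j) (Pi.single j 1)
      map_add' := fun x y => by
        simp only [Pi.add_apply, add_tmul]
        exact Finset.sum_add_distrib
      map_smul' := fun a x => (map_sum (BalancedTensor.map (smulEnd A R T a) LinearMap.id)
        (fun j => tmul R (x j) (Pi.single j 1)) Finset.univ).symm }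
    (by
      refine LinearMap.ext fun x => ?_
      change tensorPiHom R T n (∑ j, tmul R (x j) (Pi.single j 1)) = x
      refine (map_sum (tensorPiHom R T n) _ _).trans (funext fun i => ?_)
      refine (Finset.sum_apply i _ _).trans ?_
      change ∑ j, op ((Pi.single j 1 : Fin n → R) i) • x j = x i
      rw [Finset.sum_eq_single i]
      · simp
      · intro j _ hj
        rw [Pi.single_eq_of_ne hj.symm, op_zero, zero_smul]
      · simp)
    (by
      refine LinearMap.ext fun x => ?_
      induction x using BalancedTensor.induction_on with
      | zero => exact map_zero _
      | tmul t c =>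
        change ∑ j, tmul R (op (c j) • t) (Pi.single j 1) = tmul R t c
        conv_rhs => rw [pi_eq_sum_univ' c, ← mk_apply, map_sum]
        exact Finset.sum_congr rfl fun j _ => smul_tmul _ _ _
      | add x y hx hy => exact (map_add _ _ _).trans (congrArg₂ _ hx hy))

instance (n : ℕ) [Module.Finite A T] : Module.Finite A (TensorModule R T (Fin n → R)) :=
  Module.Finite.equiv (tensorPiEquiv T n).symm

instance (n : ℕ) [Module.Projective A T] : Module.Projective A (TensorModule R T (Fin n → R)) := by
  have : Module.Projective A (Fin n → T) :=
    Module.Projective.of_equiv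
      (DFinsupp.linearEquivFunOnFintype (ι := Fin n) (R := A) (M := fun _ => T))
  exact Module.Projective.of_equiv (tensorPiEquiv T n).symm

variable (R M) in
theorem finite_tensorModule [Module.Finite A T] [Module.Finite R M] :
    Module.Finite A (TensorModule R T M) := by
  obtain ⟨n, s, hs⟩ := Module.Finite.exists_fin' R M
  exact Module.Finite.of_surjective _ (tensorMap_surjective (A := A) T hs)

variable {T} in
/-- `T ⊗_R -` preserves approximations: `Hom_A(T ⊗_R M, A) = Hom_R(M, Hom_A(T, A))`, and maps into
the flat module `Hom_A(T, A)` factor through projective modules. -/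
theorem DualSurjective.tensorMap [IsNoetherianRing R] (hT : IsFlatLeft R (BimoduleDual A R T))
    [Module.Finite R M] {g : M →ₗ[R] M'} (hg : DualSurjective g) :
    DualSurjective (tensorMap A T g) := by
  intro α
  let u : M →ₗ[R] BimoduleDual A R T :=
    { toFun := fun m => (show T →ₗ[A] A from
        { toFun := fun t => α (tmul R t m)
          map_add' := fun t t' => (congrArg α (add_tmul t t' m)).trans (map_add α _ _)
          map_smul' := fun a t => map_smul α a (show TensorModule R T M from tmul R t m) })
      map_add' := fun m m' => LinearMap.ext fun t =>
        (congrArg α (tmul_add t m m')).trans (map_add α _ _)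
      map_smul' := fun r m => LinearMap.ext fun t => congrArg α (smul_tmul r t m).symm }
  obtain ⟨Q, κ, v, hQ, hu⟩ := hT.exists_factorization u
  obtain ⟨κ', hκ'⟩ := hg.exists_extend κ
  let w : M' → T →ₗ[A] A := fun m => v (κ' m)
  have hw : ∀ m t, w (g m) t = α (tmul R t m) := fun m t => by
    have h1 : v (κ' (g m)) = u m := by
      rw [← hu, ← hκ']
      rfl
    exact LinearMap.congr_fun h1 t
  have hw_add : ∀ m m', w (m + m') = w m + w m' := fun m m' => by
    change v (κ' (m + m')) = v (κ' m) + v (κ' m')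
    rw [map_add, map_add]
  have hw_smul : ∀ (r : R) m t, w m (op r • t) = w (r • m) t := fun r m t => by
    have h1 : v (κ' (r • m)) = r • v (κ' m) := by rw [map_smul, map_smul]
    exact (LinearMap.congr_fun h1 t).symm
  refine ⟨TensorModule.linearMapOfTmul R T M'
    (lift (AddMonoidHom.mk' (fun t => AddMonoidHom.mk' (fun m => w m t)
      fun m m' => LinearMap.congr_fun (hw_add m m') t)
      fun t t' => AddMonoidHom.ext fun m => map_add (w m) t t')
      fun r t m => hw_smul r m t)
    fun a t m => map_smul (w m) a t, LinearMap.ext fun x => ?_⟩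
  induction x using BalancedTensor.induction_on with
  | zero => exact (map_zero _).trans (map_zero α).symm
  | tmul t m => exact hw m t
  | add x y hx hy =>
    exact (map_add _ (x : TensorModule R T M) y).trans
      ((congrArg₂ _ hx hy).trans (map_add α (x : TensorModule R T M) y).symm)

variable {T} in
/-- A finitely generated `R`-module `M` is `k`-torsionfree if and only if `T ⊗_R M` is. -/
theorem torsionfreeModule_tensorModule_iff [IsNoetherianRing R] [IsNoetherianRing Rᵐᵒᵖ]
    [IsNoetherianRing A] [IsNoetherianRing Aᵐᵒᵖ] [Module.Finite A T] [Module.Projective A T]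
    (hT : IsFaithfullyFlatRight R T) (hT' : IsFlatLeft R (BimoduleDual A R T)) (k : ℕ)
    (M : Type u) [AddCommGroup M] [Module R M] [Module.Finite R M] :
    TorsionfreeModule A k (TensorModule R T M) ↔ TorsionfreeModule R k M := by
  induction k generalizing M with
  | zero =>
    exact iff_of_true (torsionfreeModule_zero_iff.2 (finite_tensorModule R T M))
      (torsionfreeModule_zero_iff.2 inferInstance)
  | succ k ih =>
    have := finite_tensorModule (A := A) R T M
    obtain ⟨n, g, hg⟩ := exists_dualSurjective (S := R) M
    have hex := LinearMap.exact_map_mkQ_range g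
    have hh := Submodule.mkQ_surjective (LinearMap.range g)
    rw [torsionfreeModule_succ_iff hg hex hh, torsionfreeModule_succ_iff (hg.tensorMap hT')
      (tensorMap_exact T hex hh) (tensorMap_surjective T hh), ih, hT.tensorMap_injective_iff]

/-! ### Transfer of closure under extensions -/

theorem isClosedUnderExtensions_of_restrictScalars {φ : R →+* A} {k : ℕ}
    (hres : ∀ M : ModuleCat.{u} A,
      kTorsionfree R k ((ModuleCat.restrictScalars φ).obj M) ↔ kTorsionfree A k M)
    (hR : (kTorsionfree R k).IsClosedUnderExtensions) :
    (kTorsionfree A k).IsClosedUnderExtensions := by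
  refine ⟨fun {X} hX h1 h3 => (hres _).1 ?_⟩
  have hX' : (X.map (ModuleCat.restrictScalars φ)).ShortExact :=
    ModuleCat.shortComplex_shortExact _
      ((ShortComplex.ShortExact.moduleCat_exact_iff_function_exact X).1 hX.exact)
      hX.moduleCat_injective_f hX.moduleCat_surjective_g
  exact hR.prop_X₂_of_shortExact hX' ((hres _).2 h1) ((hres _).2 h3)

variable {T} in
theorem isClosedUnderExtensions_of_tensorModule [IsNoetherianRing R] [IsNoetherianRing Rᵐᵒᵖ]
    [IsNoetherianRing A] [IsNoetherianRing Aᵐᵒᵖ] [Module.Finite A T] [Module.Projective A T]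
    (hT : IsFaithfullyFlatRight R T) (hT' : IsFlatLeft R (BimoduleDual A R T)) {k : ℕ}
    (hA : (kTorsionfree A k).IsClosedUnderExtensions) :
    (kTorsionfree R k).IsClosedUnderExtensions := by
  refine ⟨fun {X} hX h1 h3 => ?_⟩
  have hf1 : Module.Finite R X.X₁ := h1.1
  have hf3 : Module.Finite R X.X₃ := h3.1
  have hex : Function.Exact X.f.hom X.g.hom :=
    (ShortComplex.ShortExact.moduleCat_exact_iff_function_exact X).1 hX.exact
  have hinj : Function.Injective X.f.hom := hX.moduleCat_injective_f
  have hsurj : Function.Surjective X.g.hom := hX.moduleCat_surjective_g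
  have hf2 : Module.Finite R X.X₂ := by
    have := isNoetherian_of_range_eq_ker X.f.hom X.g.hom (LinearMap.exact_iff.1 hex).symm
    infer_instance
  have hTX : (ModuleCat.shortComplexOfCompEqZero _ _
      (tensorMap_exact (A := A) T hex hsurj).linearMap_comp_eq_zero).ShortExact :=
    ModuleCat.shortComplex_shortExact _ (tensorMap_exact T hex hsurj)
      ((hT.tensorMap_injective_iff X.f.hom).2 hinj) (tensorMap_surjective T hsurj)
  have key := torsionfreeModule_tensorModule_iff (A := A) hT hT' k
  exact (key X.X₂).1 (hA.prop_X₂_of_shortExact hTX ((key X.X₁).2 h1) ((key X.X₃).2 h3))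

end Extension
end TorsionfreeExt
end

theorem theorem5p7 {R A : Type u} [Ring R] [Ring A] [IsNoetherianRing R] [IsNoetherianRing Rᵐᵒᵖ]
    (φ : R →+* A) (hfin : TorsionfreeExt.IsFiniteHom φ)
    (hqff : TorsionfreeExt.IsQuasiFaithfullyFlat φ)
    (hGp : TorsionfreeExt.IsGorensteinProjective R (TorsionfreeExt.leftModuleVia φ))
    (hproj : Module.Projective A ((ModuleCat.coextendScalars φ).obj (ModuleCat.of R R)))
    (k : ℕ) (hk : 0 < k) :
    (TorsionfreeExt.kTorsionfree R k).IsClosedUnderExtensions ↔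
      (TorsionfreeExt.kTorsionfree A k).IsClosedUnderExtensions := by
  have hA := TorsionfreeExt.isNoetherianRing_of_isFiniteHom φ hfin
  have := hA.1
  have := hA.2
  refine ⟨TorsionfreeExt.isClosedUnderExtensions_of_restrictScalars
    (TorsionfreeExt.torsionfreeModule_restrictScalars_iff φ hfin hGp hproj k), fun h => ?_⟩
  obtain ⟨T, _, _, _, _, _, _, hT, hT'⟩ := hqff
  exact TorsionfreeExt.isClosedUnderExtensions_of_tensorModule hT hT' h
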